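/- Let $p$ be a prime and let $K/\mathbb{Q}_p$ be an unramified extension of finite degree $n$, with ring of integers $\mathcal{O}_K$, maximal ideal $\mathfrak{m}_K = p\mathcal{O}_K$ and residue field $k$; write $N_{k/\mathbb{F}_p}\colon k\to\mathbb{F}_p$ for the norm map and $\overline{c}\in k$ for the residue class of $c\in\mathcal{O}_K$. Let $E/K$ be an elliptic curve given by a Weierstrass equation $$Y^2+a_1XY+a_3Y=X^3+a_2X^2+a_4X+a_6,\qquad a_i\in\mathfrak{m}_K \text{ for each } i,$$ and let $E_0(K)\subseteq E(K)$ be the subgroup of the points whose reduction is a nonsingular point of the reduced curve over $k$. Equip $E(K)\subseteq\mathbb{P}^2(K)$ with the $p$-adic topology. Then $E_0(K)$ has a unique structure of $\mathbb{Z}_p$-module for which the map $\mathbb{Z}_p\to E_0(K)$, $c\mapsto cP$, is continuous for every $P\in E_0(K)$. With this structure, $E_0(K)\cong\mathbb{Z}_p^n$ as $\mathbb{Z}_p$-modules if and only if none of the following four cases occurs: (i) $p=2$ and the equation $\overline{a_3/2}\,x^3+\overline{a_1/2}\,x-1=0$ has a solution in $k$; (ii) $p=3$ and $N_{k/\mathbb{F}_p}(\overline{8a_2/3})=1$;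 (iii) $p=5$ and $N_{k/\mathbb{F}_p}(\overline{3a_4/5})=1$; (iv) $p=7$ and $N_{k/\mathbb{F}_p}(\overline{4a_6/7})=1$. In case (i) one has $E_0(K)\cong\mathbb{Z}_2^n\times(\mathbb{Z}/2\mathbb{Z})^b$ as $\mathbb{Z}_2$-modules, where $2^b$ is the number of solutions of $\overline{a_3/2}\,X^4+\overline{a_1/2}\,X^2-X=0$ in $k$. In the cases (ii)-(iv) one has $E_0(K)\cong\mathbb{Z}_p^n\times\mathbb{Z}/p\mathbb{Z}$ as $\mathbb{Z}_p$-modules. -/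

import Mathlib

open scoped LinearAlgebra.Projectivization

namespace AdditiveReduction

/-! ### Points of a Weierstrass curve in the projective plane, and their topology -/

section Topology

variable {K : Type*} [Field K]

/-- The embedding `E(K) → ℙ²(K)`: `∞ ↦ (0 : 1 : 0)` and `(x, y) ↦ (x : y : 1)`. -/
noncomputable def toPlane {E : WeierstrassCurve.Affine K} : E.Point → ℙ K (Fin 3 → K)
  | .zero => Projectivization.mk K ![0, 1, 0] (fun h => one_ne_zero (congrFun h 1))
  | .some x y _ => Projectivization.mk K ![x, y, 1] (fun h => one_ne_zero (congrFun h 2))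

variable [TopologicalSpace K]

/-- `ℙ²(K)` carries the quotient topology from `K³ ∖ {0}`. -/
instance planeTopology : TopologicalSpace (ℙ K (Fin 3 → K)) :=
  TopologicalSpace.coinduced (Projectivization.mk' K) inferInstance

/-- The standard topology on `E(K)`: the one induced from `ℙ²(K)`. -/
noncomputable instance pointTopology (E : WeierstrassCurve.Affine K) : TopologicalSpace E.Point :=
  TopologicalSpace.induced toPlane inferInstance

end Topology

/-! ### Points of good reduction -/

section Reduction

set_option linter.overlappingInstances false

variable {R : Type*} [CommRing R] [IsLocalRing R] {K : Type*} [Field K] [Algebra R K]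

/-- The point `P ∈ E(K)` reduces to a nonsingular point of the special fibre: it has projective
coordinates `v` in `R` whose reduction modulo the maximal ideal of `R` is (a representative of)
a nonsingular point of the reduced curve. -/
def HasNonsingularReduction (W : WeierstrassCurve R) (P : (W.baseChange K).toAffine.Point) :
    Prop :=
  ∃ (v : Fin 3 → R) (hv : (fun i => algebraMap R K (v i)) ≠ 0),
    toPlane P = Projectivization.mk K (fun i => algebraMap R K (v i)) hv ∧
    (W.map (IsLocalRing.residue R)).toProjective.Nonsingular fun i => IsLocalRing.residue R (v i)

/-- All the coefficients `a₁, a₂, a₃, a₄, a₆` lie in the maximal ideal. -/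
structure CoeffsInMaximalIdeal (W : WeierstrassCurve R) : Prop where
  a₁ : W.a₁ ∈ IsLocalRing.maximalIdeal R
  a₂ : W.a₂ ∈ IsLocalRing.maximalIdeal R
  a₃ : W.a₃ ∈ IsLocalRing.maximalIdeal R
  a₄ : W.a₄ ∈ IsLocalRing.maximalIdeal R
  a₆ : W.a₆ ∈ IsLocalRing.maximalIdeal R

lemma hasNonsingularReduction_zero (W : WeierstrassCurve R) :
    HasNonsingularReduction W (0 : (W.baseChange K).toAffine.Point) := by
  have e1 : (fun i => algebraMap R K (![0, 1, 0] i)) = ![0, 1, 0] := by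
    ext i; fin_cases i <;> simp
  have e2 : (fun i => IsLocalRing.residue R (![0, 1, 0] i)) = ![0, 1, 0] := by
    ext i; fin_cases i <;> simp
  refine ⟨![0, 1, 0], ?_, ?_, ?_⟩
  · rw [e1]; exact fun h => one_ne_zero (congrFun h 1)
  · show toPlane WeierstrassCurve.Affine.Point.zero = _
    simp only [toPlane, e1]
  · rw [e2]; exact WeierstrassCurve.Projective.nonsingular_zero

/-- In terms of the coordinates `z = x / y` and `w = 1 / y`. -/
lemma hasNonsingularReduction_some {W : WeierstrassCurve R} (hW : CoeffsInMaximalIdeal W)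
    (hinj : Function.Injective (algebraMap R K)) {x y : K}
    (h : (W.baseChange K).toAffine.Nonsingular x y) :
    HasNonsingularReduction W (.some x y h) ↔
      ∃ z w : R, x = algebraMap R K z * y ∧ algebraMap R K w * y = 1 := by
  have r1 := (IsLocalRing.residue_eq_zero_iff _).2 hW.a₁
  have r2 := (IsLocalRing.residue_eq_zero_iff _).2 hW.a₂
  have r3 := (IsLocalRing.residue_eq_zero_iff _).2 hW.a₃
  have r4 := (IsLocalRing.residue_eq_zero_iff _).2 hW.a₄
  have r6 := (IsLocalRing.residue_eq_zero_iff _).2 hW.a₆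
  constructor
  · rintro ⟨v, hv, hP, hns⟩
    rw [WeierstrassCurve.Projective.nonsingular_iff, WeierstrassCurve.Projective.equation_iff]
      at hns
    simp only [WeierstrassCurve.toProjective, WeierstrassCurve.map_a₁, WeierstrassCurve.map_a₂,
      WeierstrassCurve.map_a₃, WeierstrassCurve.map_a₄, WeierstrassCurve.map_a₆,
      r1, r2, r3, r4, r6, zero_mul, mul_zero, add_zero] at hns
    obtain ⟨heq, hns⟩ := hns
    have hu : IsUnit (v 1) := by
      by_contra hu
      have h1 : IsLocalRing.residue R (v 1) = 0 := (IsLocalRing.residue_eq_zero_iff _).2 hu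
      rw [h1] at heq hns
      have h0 : IsLocalRing.residue R (v 0) = 0 := by
        have : IsLocalRing.residue R (v 0) ^ 3 = 0 := by linear_combination -heq
        exact pow_eq_zero_iff (by norm_num) |>.1 this
      rw [h0] at hns
      simp at hns
    obtain ⟨u, hu⟩ := hu
    obtain ⟨t, ht⟩ := (Projectivization.mk_eq_mk_iff' K _ _ _ _).1 hP
    have t0 : t * algebraMap R K (v 0) = x := congrFun ht 0
    have t1 : t * algebraMap R K (v 1) = y := congrFun ht 1
    have t2 : t * algebraMap R K (v 2) = 1 := congrFun ht 2
    have hinv : algebraMap R K (↑u⁻¹) * algebraMap R K (v 1) = 1 := by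
      rw [← map_mul, ← hu]; simp
    refine ⟨v 0 * ↑u⁻¹, v 2 * ↑u⁻¹, ?_, ?_⟩
    · rw [← t0, ← t1, map_mul]; linear_combination (-t * algebraMap R K (v 0)) * hinv
    · rw [← t1, map_mul]; linear_combination (t * algebraMap R K (v 2)) * hinv + t2
  · rintro ⟨z, w, hx, hy⟩
    have hy0 : y ≠ 0 := by rintro rfl; simp at hy
    have e1 : (fun i => algebraMap R K (![z, 1, w] i)) =
        ![algebraMap R K z, 1, algebraMap R K w] := by
      ext i; fin_cases i <;> simp
    refine ⟨![z, 1, w], ?_, ?_, ?_⟩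
    · rw [e1]; exact fun h => one_ne_zero (congrFun h 1)
    · refine (Projectivization.mk_eq_mk_iff' K _ _ _ _).2 ⟨y, ?_⟩
      rw [e1]
      ext i
      fin_cases i
      · simp [hx, mul_comm]
      · simp
      · simpa [mul_comm] using hy
    · have hE := h.1
      rw [WeierstrassCurve.Affine.equation_iff] at hE
      simp only [WeierstrassCurve.toAffine, WeierstrassCurve.baseChange, WeierstrassCurve.map_a₁,
        WeierstrassCurve.map_a₂, WeierstrassCurve.map_a₃, WeierstrassCurve.map_a₄,
        WeierstrassCurve.map_a₆] at hE
      have hR : w + W.a₁ * z * w + W.a₃ * w ^ 2 =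
          z ^ 3 + W.a₂ * z ^ 2 * w + W.a₄ * z * w ^ 2 + W.a₆ * w ^ 3 := by
        apply hinj
        simp only [map_add, map_mul, map_pow]
        have hw : algebraMap R K w = y⁻¹ := eq_inv_of_mul_eq_one_left hy
        have hz : algebraMap R K z = x * y⁻¹ := by rw [hx]; field_simp
        rw [hw, hz]
        field_simp
        linear_combination hE
      have hk := congrArg (IsLocalRing.residue R) hR
      simp only [map_add, map_mul, map_pow, r1, r2, r3, r4, r6, zero_mul, add_zero] at hk
      rw [WeierstrassCurve.Projective.nonsingular_iff, WeierstrassCurve.Projective.equation_iff]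
      simp only [WeierstrassCurve.toProjective, WeierstrassCurve.map_a₁, WeierstrassCurve.map_a₂,
        WeierstrassCurve.map_a₃, WeierstrassCurve.map_a₄, WeierstrassCurve.map_a₆,
        r1, r2, r3, r4, r6, zero_mul, mul_zero, add_zero]
      simp [hk]

/-- A point of the curve on a line `κ y + μ x = 1` with integral `κ`, `μ` has good reduction. -/
lemma exists_integral_of_line [IsDomain R] [ValuationRing R] [IsFractionRing R K]
    {W : WeierstrassCurve R} (hW : CoeffsInMaximalIdeal W) {x y : K}
    (h : (W.baseChange K).toAffine.Equation x y) {κ μ : R}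
    (hl : algebraMap R K κ * y + algebraMap R K μ * x = 1) :
    ∃ z w : R, x = algebraMap R K z * y ∧ algebraMap R K w * y = 1 := by
  have key : ∀ t : R, x = algebraMap R K t * y →
      ∃ z w : R, x = algebraMap R K z * y ∧ algebraMap R K w * y = 1 := by
    intro t ht
    refine ⟨t, κ + μ * t, ht, ?_⟩
    rw [map_add, map_mul]
    linear_combination hl - algebraMap R K μ * ht
  by_cases hx : x = 0
  · exact key 0 (by simp [hx])
  rcases ValuationRing.isInteger_or_isInteger R (y / x) with ⟨t, ht⟩ | ⟨t, ht⟩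
  · have ht' : y = algebraMap R K t * x := by rw [ht]; field_simp
    by_cases hu : IsUnit t
    · obtain ⟨u, rfl⟩ := hu
      refine key ↑u⁻¹ ?_
      rw [ht', ← mul_assoc, ← map_mul]; simp
    · exfalso
      rw [WeierstrassCurve.Affine.equation_iff] at h
      simp only [WeierstrassCurve.toAffine, WeierstrassCurve.baseChange, WeierstrassCurve.map_a₁,
        WeierstrassCurve.map_a₂, WeierstrassCurve.map_a₃, WeierstrassCurve.map_a₄,
        WeierstrassCurve.map_a₆] at h
      have hs : algebraMap R K (κ * t + μ) * x = 1 := by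
        rw [map_add, map_mul]; linear_combination hl - algebraMap R K κ * ht'
      set s := κ * t + μ
      have h1 : (1 : R) = t * (t * s) + W.a₁ * (t * s) + W.a₃ * (t * s ^ 2) - W.a₂ * s
          - W.a₄ * s ^ 2 - W.a₆ * s ^ 3 := by
        apply IsFractionRing.injective R K
        simp only [map_add, map_sub, map_mul, map_pow, map_one]
        have hs' : algebraMap R K s = x⁻¹ := eq_inv_of_mul_eq_one_left hs
        rw [hs', ht]
        field_simp
        linear_combination -h
      have hm : (1 : R) ∈ IsLocalRing.maximalIdeal R := by
        have ht : t ∈ IsLocalRing.maximalIdeal R := hu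
        rw [h1]
        refine sub_mem (sub_mem (sub_mem (add_mem (add_mem ?_ ?_) ?_) ?_) ?_) ?_ <;>
        apply Ideal.mul_mem_right
        exacts [ht, hW.a₁, hW.a₃, hW.a₂, hW.a₄, hW.a₆]
      exact (IsLocalRing.mem_maximalIdeal _).1 hm isUnit_one
  · by_cases hy : y = 0
    · rw [hy] at ht hl
      have hl' : algebraMap R K μ * x = 1 := by simpa using hl
      exfalso
      rw [WeierstrassCurve.Affine.equation_iff] at h
      simp only [WeierstrassCurve.toAffine, WeierstrassCurve.baseChange, WeierstrassCurve.map_a₁,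
        WeierstrassCurve.map_a₂, WeierstrassCurve.map_a₃, WeierstrassCurve.map_a₄,
        WeierstrassCurve.map_a₆] at h
      have h1 : (1 : R) = - W.a₂ * μ - W.a₄ * μ ^ 2 - W.a₆ * μ ^ 3 := by
        apply IsFractionRing.injective R K
        simp only [map_sub, map_mul, map_pow, map_one, map_neg]
        have hs' : algebraMap R K μ = x⁻¹ := eq_inv_of_mul_eq_one_left hl'
        rw [hs']
        field_simp
        rw [hy] at h
        linear_combination -h
      have hm : (1 : R) ∈ IsLocalRing.maximalIdeal R := by
        rw [h1]
        refine sub_mem (sub_mem ?_ ?_) ?_ <;>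
        apply Ideal.mul_mem_right
        exacts [neg_mem hW.a₂, hW.a₄, hW.a₆]
      exact (IsLocalRing.mem_maximalIdeal _).1 hm isUnit_one
    · refine key t ?_
      rw [ht]; field_simp

lemma isUnit_of_sub_mem {u : R} (h : u - 1 ∈ IsLocalRing.maximalIdeal R) : IsUnit u := by
  by_contra hu
  have hu' : u ∈ IsLocalRing.maximalIdeal R := hu
  have : (1 : R) ∈ IsLocalRing.maximalIdeal R := by
    simpa only [sub_sub_cancel] using sub_mem hu' h
  exact (IsLocalRing.mem_maximalIdeal _).1 this isUnit_one

lemma hasNonsingularReduction_neg [IsDomain R] [IsFractionRing R K]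
    {W : WeierstrassCurve R} (hW : CoeffsInMaximalIdeal W)
    {P : (W.baseChange K).toAffine.Point} (hP : HasNonsingularReduction W P) :
    HasNonsingularReduction W (-P) := by
  have hinj := IsFractionRing.injective R K
  rcases P with _ | ⟨x, y, h⟩
  · exact hP
  · rw [hasNonsingularReduction_some hW hinj] at hP
    obtain ⟨z, w, hx, hy⟩ := hP
    rw [WeierstrassCurve.Affine.Point.neg_some, hasNonsingularReduction_some hW hinj]
    have hu : IsUnit (1 + W.a₁ * z + W.a₃ * w) := by
      apply isUnit_of_sub_mem
      have : 1 + W.a₁ * z + W.a₃ * w - 1 = W.a₁ * z + W.a₃ * w := by ring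
      rw [this]
      exact add_mem (Ideal.mul_mem_right _ _ hW.a₁) (Ideal.mul_mem_right _ _ hW.a₃)
    obtain ⟨u, hu⟩ := hu
    have hinv : algebraMap R K (↑u⁻¹) *
        (1 + algebraMap R K W.a₁ * algebraMap R K z + algebraMap R K W.a₃ * algebraMap R K w)
          = 1 := by
      simp only [← map_mul, ← map_add, ← map_one (algebraMap R K), ← hu]
      simp
    have hn : (W.baseChange K).toAffine.negY x y =
        -(1 + algebraMap R K W.a₁ * algebraMap R K z + algebraMap R K W.a₃ * algebraMap R K w)
          * y := by
      simp only [WeierstrassCurve.Affine.negY, WeierstrassCurve.toAffine,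
        WeierstrassCurve.baseChange, WeierstrassCurve.map_a₁, WeierstrassCurve.map_a₃]
      linear_combination (-algebraMap R K W.a₁) * hx + algebraMap R K W.a₃ * hy
    refine ⟨-z * ↑u⁻¹, -w * ↑u⁻¹, ?_, ?_⟩
    · rw [hn, map_mul, map_neg]
      linear_combination hx - algebraMap R K z * y * hinv
    · rw [hn, map_mul, map_neg]
      linear_combination hy + algebraMap R K w * y * hinv

lemma hasNonsingularReduction_add [IsDomain R] [ValuationRing R] [IsFractionRing R K]
    [DecidableEq K] {W : WeierstrassCurve R} (hW : CoeffsInMaximalIdeal W)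
    {P Q : (W.baseChange K).toAffine.Point} (hP : HasNonsingularReduction W P)
    (hQ : HasNonsingularReduction W Q) : HasNonsingularReduction W (P + Q) := by
  have hinj := IsFractionRing.injective R K
  rcases P with _ | ⟨x₁, y₁, h₁⟩
  · rw [← WeierstrassCurve.Affine.Point.zero_def, zero_add]; exact hQ
  rcases Q with _ | ⟨x₂, y₂, h₂⟩
  · rw [← WeierstrassCurve.Affine.Point.zero_def, add_zero]; exact hP
  by_cases hxy : x₁ = x₂ ∧ y₁ = (W.baseChange K).toAffine.negY x₂ y₂
  · rw [WeierstrassCurve.Affine.Point.add_of_Y_eq hxy.1 hxy.2]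
    exact hasNonsingularReduction_zero W
  rw [WeierstrassCurve.Affine.Point.add_some hxy]
  refine hasNonsingularReduction_neg hW (P := .some _ _
    (WeierstrassCurve.Affine.nonsingular_negAdd h₁ h₂ hxy)) ?_
  rw [hasNonsingularReduction_some hW hinj] at hP hQ ⊢
  obtain ⟨z₁, w₁, hx₁, hy₁⟩ := hP
  obtain ⟨z₂, w₂, hx₂, hy₂⟩ := hQ
  have hE₁ := h₁.1
  have hE₂ := h₂.1
  rw [WeierstrassCurve.Affine.equation_iff] at hE₁ hE₂
  simp only [WeierstrassCurve.toAffine, WeierstrassCurve.baseChange, WeierstrassCurve.map_a₁,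
    WeierstrassCurve.map_a₂, WeierstrassCurve.map_a₃, WeierstrassCurve.map_a₄,
    WeierstrassCurve.map_a₆] at hE₁ hE₂
  have curve : ∀ {x y : K} {z w : R}, x = algebraMap R K z * y → algebraMap R K w * y = 1 →
      y ^ 2 + algebraMap R K W.a₁ * x * y + algebraMap R K W.a₃ * y =
        x ^ 3 + algebraMap R K W.a₂ * x ^ 2 + algebraMap R K W.a₄ * x + algebraMap R K W.a₆ →
      w + W.a₁ * z * w + W.a₃ * w ^ 2 =
        z ^ 3 + W.a₂ * z ^ 2 * w + W.a₄ * z * w ^ 2 + W.a₆ * w ^ 3 := by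
    intro x y z w hx hy hE
    apply hinj
    simp only [map_add, map_mul, map_pow]
    have hy0 : y ≠ 0 := by rintro rfl; simp at hy
    have hw : algebraMap R K w = y⁻¹ := eq_inv_of_mul_eq_one_left hy
    have hz : algebraMap R K z = x * y⁻¹ := by rw [hx]; field_simp
    rw [hw, hz]
    field_simp
    linear_combination hE
  have c₁ := curve hx₁ hy₁ hE₁
  have c₂ := curve hx₂ hy₂ hE₂
  obtain ⟨u, hu⟩ : IsUnit (1 + W.a₁ * z₁ + W.a₃ * (w₁ + w₂) - W.a₂ * z₁ ^ 2
      - W.a₄ * (z₁ * (w₁ + w₂)) - W.a₆ * (w₁ ^ 2 + w₁ * w₂ + w₂ ^ 2)) := by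
    apply isUnit_of_sub_mem
    have : 1 + W.a₁ * z₁ + W.a₃ * (w₁ + w₂) - W.a₂ * z₁ ^ 2
      - W.a₄ * (z₁ * (w₁ + w₂)) - W.a₆ * (w₁ ^ 2 + w₁ * w₂ + w₂ ^ 2) - 1 =
      W.a₁ * z₁ + W.a₃ * (w₁ + w₂) - W.a₂ * z₁ ^ 2
      - W.a₄ * (z₁ * (w₁ + w₂)) - W.a₆ * (w₁ ^ 2 + w₁ * w₂ + w₂ ^ 2) := by ring
    rw [this]
    refine sub_mem (sub_mem (sub_mem (add_mem ?_ ?_) ?_) ?_) ?_ <;> apply Ideal.mul_mem_right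
    exacts [hW.a₁, hW.a₃, hW.a₂, hW.a₄, hW.a₆]
  set V := -(W.a₁ * w₂) + z₁ ^ 2 + z₁ * z₂ + z₂ ^ 2 + W.a₂ * w₂ * (z₁ + z₂) + W.a₄ * w₂ ^ 2
    with hV
  have huu : (↑u⁻¹ : R) * ↑u = 1 := by simp
  -- the line through the two points, in the coordinates `z`, `w`
  obtain ⟨l, hl⟩ : ∃ l : R, l * ↑u = V := ⟨V * ↑u⁻¹, by rw [mul_assoc, huu, mul_one]⟩
  have hdiff : w₁ - w₂ = l * (z₁ - z₂) := by
    have : (w₁ - w₂) * ↑u = V * (z₁ - z₂) := by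
      rw [hu, hV]; linear_combination c₁ - c₂
    linear_combination ↑u⁻¹ * this - (w₁ - w₂) * huu + l * (z₁ - z₂) * huu
      - ↑u⁻¹ * (z₁ - z₂) * hl
  have line₁ : algebraMap R K (w₁ - l * z₁) * y₁ + algebraMap R K l * x₁ = 1 := by
    rw [map_sub, map_mul]; linear_combination hy₁ + algebraMap R K l * hx₁
  have line₂ : algebraMap R K (w₁ - l * z₁) * y₂ + algebraMap R K l * x₂ = 1 := by
    have e : w₁ - l * z₁ = w₂ - l * z₂ := by linear_combination hdiff
    rw [e, map_sub, map_mul]; linear_combination hy₂ + algebraMap R K l * hx₂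
  have hslope : algebraMap R K (w₁ - l * z₁) * (W.baseChange K).toAffine.slope x₁ x₂ y₁ y₂
      + algebraMap R K l = 0 := by
    by_cases hx : x₁ = x₂
    · have hyn : y₁ ≠ (W.baseChange K).toAffine.negY x₂ y₂ := fun h => hxy ⟨hx, h⟩
      have hyy : y₁ = y₂ := WeierstrassCurve.Affine.Y_eq_of_Y_ne h₁.1 h₂.1 hx hyn
      rw [WeierstrassCurve.Affine.slope_of_Y_ne hx hyn]
      subst hx hyy
      have hy0 : y₁ ≠ 0 := by rintro rfl; simp at hy₁
      have hw : algebraMap R K w₁ = y₁⁻¹ := eq_inv_of_mul_eq_one_left hy₁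
      have hw₂ : algebraMap R K w₂ = y₁⁻¹ := eq_inv_of_mul_eq_one_left hy₂
      have hz : algebraMap R K z₁ = x₁ * y₁⁻¹ := by rw [eq_mul_inv_iff_mul_eq₀ hy0, ← hx₁]
      have hz₂ : algebraMap R K z₂ = x₁ * y₁⁻¹ := by rw [eq_mul_inv_iff_mul_eq₀ hy0, ← hx₂]
      have hD : y₁ - (W.baseChange K).toAffine.negY x₁ y₁ ≠ 0 := sub_ne_zero.2 hyn
      have hu0 : algebraMap R K (u : R) ≠ 0 := by
        exact (u.isUnit.map (algebraMap R K)).ne_zero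
      have hlK : algebraMap R K l * algebraMap R K (u : R) = algebraMap R K V := by
        rw [← map_mul, hl]
      have hVK : algebraMap R K V * y₁ ^ 2 = 3 * x₁ ^ 2 + 2 * algebraMap R K W.a₂ * x₁
          + algebraMap R K W.a₄ - algebraMap R K W.a₁ * y₁ := by
        rw [hV]
        simp only [map_add, map_mul, map_pow, map_neg, hw₂, hz, hz₂]
        field_simp
        ring
      have hUK : algebraMap R K (u : R) * y₁ ^ 2 = y₁ ^ 2 + algebraMap R K W.a₁ * x₁ * y₁
          + 2 * algebraMap R K W.a₃ * y₁ - algebraMap R K W.a₂ * x₁ ^ 2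
          - 2 * algebraMap R K W.a₄ * x₁ - 3 * algebraMap R K W.a₆ := by
        rw [hu]
        simp only [map_add, map_sub, map_mul, map_pow, map_one, hw, hw₂, hz]
        field_simp
        ring
      simp only [WeierstrassCurve.Affine.negY, WeierstrassCurve.toAffine,
        WeierstrassCurve.baseChange, WeierstrassCurve.map_a₁, WeierstrassCurve.map_a₂,
        WeierstrassCurve.map_a₃, WeierstrassCurve.map_a₄] at hD ⊢
      rw [← hVK, map_sub, map_mul, hw, hz, ← hlK]
      generalize algebraMap R K l = L at *
      generalize algebraMap R K (u : R) = U at *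
      rw [← hlK] at hVK
      rw [mul_div_assoc', div_add' _ _ _ hD, div_eq_zero_iff]
      left
      field_simp
      apply mul_left_cancel₀ hy0
      linear_combination L * (hUK - x₁ * hVK + 3 * hE₁)
    · rw [WeierstrassCurve.Affine.slope_of_X_ne hx]
      have hD : x₁ - x₂ ≠ 0 := sub_ne_zero.2 hx
      field_simp
      linear_combination line₁ - line₂
  refine exists_integral_of_line hW
    (WeierstrassCurve.Affine.nonsingular_negAdd h₁ h₂ hxy).1 (κ := w₁ - l * z₁) (μ := l) ?_
  rw [WeierstrassCurve.Affine.negAddY]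
  linear_combination line₁ + ((W.baseChange K).toAffine.addX x₁ x₂
    ((W.baseChange K).toAffine.slope x₁ x₂ y₁ y₂) - x₁) * hslope

/-- The subgroup `E₀(K) ⊆ E(K)` of the points which reduce to a nonsingular point. -/
def goodReductionSubgroup [IsDomain R] [ValuationRing R] [IsFractionRing R K] [DecidableEq K]
    (W : WeierstrassCurve R) (hW : CoeffsInMaximalIdeal W) :
    AddSubgroup (W.baseChange K).toAffine.Point where
  carrier := {P | HasNonsingularReduction W P}
  zero_mem' := hasNonsingularReduction_zero W
  add_mem' := hasNonsingularReduction_add hW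
  neg_mem' := hasNonsingularReduction_neg hW

end Reduction

/-! ### Rings of integers and residue fields -/

section Integers

/-- The ring of integers `𝒪_K = {x | ‖x‖ ≤ 1}`. -/
noncomputable abbrev Integers (K : Type*) [NormedField K] [IsUltrametricDist K] : ValuationSubring K :=
  (NormedField.valuation (K := K)).valuationSubring

/-- The residue field `k` of `𝒪_K`. -/
abbrev Residue (K : Type*) [NormedField K] [IsUltrametricDist K] : Type _ :=
  IsLocalRing.ResidueField (Integers K)

/-- `K` is unramified over `ℚ_p`, that is, `p` is a uniformizer of `K`. -/
def IsUnramified (p : ℕ) (K : Type*) [NormedField K] [IsUltrametricDist K] : Prop :=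
  IsLocalRing.maximalIdeal (Integers K) = Ideal.span {(p : Integers K)}

open Classical in
/-- The residue class of `a / p` in `k`, for `a ∈ p 𝒪_K` (and `0` for all other `a`). -/
noncomputable def divResidue (p : ℕ) {K : Type*} [NormedField K] [IsUltrametricDist K]
    (a : Integers K) : Residue K :=
  if h : ∃ c : Integers K, a = p * c then IsLocalRing.residue (Integers K) h.choose else 0

variable (p : ℕ) [Fact p.Prime] (K : Type*) [NormedField K] [NormedAlgebra ℚ_[p] K]
  [IsUltrametricDist K]

lemma norm_natCast_prime : ‖(p : K)‖ = (p : ℝ)⁻¹ := by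
  have h := norm_algebraMap' K ((p : ℕ) : ℚ_[p])
  rwa [map_natCast, Padic.norm_p] at h

lemma natCast_mem_maximalIdeal : (p : Integers K) ∈ IsLocalRing.maximalIdeal (Integers K) := by
  rw [IsLocalRing.mem_maximalIdeal, mem_nonunits_iff]
  intro hu
  obtain ⟨q, hq⟩ := hu.exists_right_inv
  have h1 : ‖(p : K)‖ * ‖(q : K)‖ = 1 := by
    rw [← norm_mul, ← norm_one (α := K)]
    exact congrArg (fun t : Integers K => ‖(t : K)‖) hq
  have h2 : ‖(q : K)‖ ≤ 1 := q.2
  have hp : (1 : ℝ) < p := by exact_mod_cast (Fact.out : p.Prime).one_lt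
  rw [norm_natCast_prime p K, inv_mul_eq_one₀ (by positivity)] at h1
  linarith

lemma charP_residue : CharP (Residue K) p := by
  apply (CharP.charP_iff_prime_eq_zero Fact.out).2
  have := (IsLocalRing.residue_eq_zero_iff _).2 (natCast_mem_maximalIdeal p K)
  rwa [map_natCast] at this

/-- The norm map from `k` to `𝔽_p`. -/
noncomputable def residueNorm : Residue K →* ZMod p :=
  letI := charP_residue p K
  letI := ZMod.algebra (Residue K) p
  Algebra.norm (ZMod p)

variable {K}

lemma divResidue_mul (c : Integers K) :
    divResidue p ((p : Integers K) * c) = IsLocalRing.residue (Integers K) c := by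
  have h : ∃ d : Integers K, (p : Integers K) * c = p * d := ⟨c, rfl⟩
  have hp : (p : Integers K) ≠ 0 := by
    intro h0
    have h1 : (p : K) = 0 := congrArg (fun t : Integers K => (t : K)) h0
    have h2 := norm_natCast_prime p K
    rw [h1, norm_zero] at h2
    exact (Fact.out : p.Prime).ne_zero (by exact_mod_cast (inv_eq_zero.1 h2.symm))
  rw [divResidue, dif_pos h, ← mul_left_cancel₀ hp h.choose_spec]

end Integers

section Exceptional

variable (p : ℕ) [Fact p.Prime] {K : Type*} [NormedField K] [NormedAlgebra ℚ_[p] K]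
  [IsUltrametricDist K] (W : WeierstrassCurve (Integers K))

/-- Case `p = 2`, where the cubic has a root in `k`. -/
def ExceptionalTwo : Prop :=
  p = 2 ∧ ∃ x : Residue K, divResidue p W.a₃ * x ^ 3 + divResidue p W.a₁ * x - 1 = 0

/-- Case `p = 3`. -/
def ExceptionalThree : Prop :=
  p = 3 ∧ residueNorm p K (8 * divResidue p W.a₂) = 1

/-- Case `p = 5`. -/
def ExceptionalFive : Prop :=
  p = 5 ∧ residueNorm p K (3 * divResidue p W.a₄) = 1

/-- Case `p = 7`. -/
def ExceptionalSeven : Prop :=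
  p = 7 ∧ residueNorm p K (4 * divResidue p W.a₆) = 1

end Exceptional

/-- A `ℤ_p`-module structure on a topological abelian group `G` is continuous if `c ↦ c • g` is
continuous on `ℤ_p` for every `g`, so that `c • g` is the limit of `m • g` for integers
`m → c`. -/
def IsContinuousModule (p : ℕ) [Fact p.Prime] {G : Type*} [AddCommGroup G] [TopologicalSpace G]
    (M : Module ℤ_[p] G) : Prop :=
  ∀ g : G, Continuous fun c : ℤ_[p] => M.smul c g

end AdditiveReduction

namespace AdditiveReduction

/-! ### Coordinates `z = x / y`, `w = 1 / y` and the group law -/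

/-! All aᵢ vanish in k, so in the coordinates z = x/y, w = 1/y the reduced curve is w = z³, and
E₀(K) consists of the points with integral z and w. The curve equation, solved for w, is a
contraction, so z is a bijection from E₀(K) to 𝒪_K (`zCoord_injective`, `zCoord_surjective`). The
chord formulas have denominators that are ≡ 1 modulo the maximal ideal, so addition is well defined
on z modulo any ideal (`map_zCoord_add_congr`). Hence the sets F_m where p^m divides z form a
complete separated filtration by subgroups, and c • P is the limit of N • P for integers N → c.
Density of ℕ in ℤ_p makes this the only continuous module structure.

If q divides z(P) and z(Q), then z(P + Q) ≡ z(P) + z(Q) modulo p q² (`dvd_zCoord_add_sub`). For m ≥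
1 this makes multiplication by p an isomorphism F_m/F_{m+1} → F_{m+1}/F_{m+2}. So F_1 is
torsion-free with p F_1 = F_2, and F_1/F_2 ≅ k has pⁿ elements: F_1 ≅ ℤ_pⁿ. Since p E₀(K) ⊆ F_1, the
torsion of E₀(K) is killed by p and E₀(K) ≅ ℤ_pⁿ × (ℤ/p)^b (`IsPadicFiltration.exists_linearEquiv`).

It remains to find b, that is, to understand multiplication by p from E₀(K)/F_1 to F_1/F_2. Modulo
p² the group law is z₁ + z₂ plus a correction linear in the aᵢ (`IsChordSum.sq_dvd_sub`), and this
correction is the coboundary of the polynomial `approxLog`, called L below (`approxLog_add`).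
Therefore z(pP) ≡ p L(z(P)) modulo p², and the p-torsion corresponds to the zeros of L in k
(`exists_linearEquiv_of_approxLog`). The nonlinear coefficients of L are, up to sign, a₁/2, a₂/3,
a₃/2, 2a₄/5, 3a₆/7; such a coefficient vanishes in k unless p is its denominator, which is why only
p = 2, 3, 5, 7 are exceptional. For odd p, L reduces to X - γ X^p, which has a nonzero zero in k
exactly when γ has norm 1 (`card_sub_mul_pow_eq_zero`); then 1 < p^b ≤ p gives b = 1. -/

/-- The chord-tangent construction for a Weierstrass curve in the coordinates `z = x / y` and
`w = 1 / y`: the line through `(z₁, w₁)` and `(z₂, w₂)` has slope `l`, its third point is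
`(z₃, w₃)`, and `(z, w)` is the inverse of that point. -/
structure IsChordSum {S : Type*} [CommRing S] (W : WeierstrassCurve S)
    (z₁ w₁ z₂ w₂ l z₃ w₃ z w : S) : Prop where
  slope : (1 + W.a₁ * z₁ + W.a₃ * (w₁ + w₂) - W.a₂ * z₁ ^ 2
      - W.a₄ * (z₁ * (w₁ + w₂)) - W.a₆ * (w₁ ^ 2 + w₁ * w₂ + w₂ ^ 2)) * l =
    -(W.a₁ * w₂) + z₁ ^ 2 + z₁ * z₂ + z₂ ^ 2 + W.a₂ * w₂ * (z₁ + z₂) + W.a₄ * w₂ ^ 2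
  third : (1 + W.a₂ * l + W.a₄ * l ^ 2 + W.a₆ * l ^ 3) * (z₁ + z₂ + z₃) =
    W.a₁ * l + W.a₃ * l ^ 2 - W.a₂ * (w₁ - l * z₁) - 2 * W.a₄ * l * (w₁ - l * z₁)
      - 3 * W.a₆ * l ^ 2 * (w₁ - l * z₁)
  line : w₃ = l * z₃ + (w₁ - l * z₁)
  negz : (1 + W.a₁ * z₃ + W.a₃ * w₃) * z = -z₃
  negw : (1 + W.a₁ * z₃ + W.a₃ * w₃) * w = -w₃

/-- The affine equation in the coordinates `z = x / y`, `w = 1 / y`. -/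
def CurveEq {S : Type*} [CommRing S] (W : WeierstrassCurve S) (z w : S) : Prop :=
  w + W.a₁ * z * w + W.a₃ * w ^ 2 = z ^ 3 + W.a₂ * z ^ 2 * w + W.a₄ * z * w ^ 2 + W.a₆ * w ^ 3

lemma CurveEq.map {S T : Type*} [CommRing S] [CommRing T] {W : WeierstrassCurve S} {z w : S}
    (h : CurveEq W z w) (f : S →+* T) : CurveEq (W.map f) (f z) (f w) := by
  have := congrArg f h
  simpa [CurveEq] using this

lemma IsChordSum.map {S T : Type*} [CommRing S] [CommRing T] {W : WeierstrassCurve S}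
    {z₁ w₁ z₂ w₂ l z₃ w₃ z w : S} (h : IsChordSum W z₁ w₁ z₂ w₂ l z₃ w₃ z w) (f : S →+* T) :
    IsChordSum (W.map f) (f z₁) (f w₁) (f z₂) (f w₂) (f l) (f z₃) (f w₃) (f z) (f w) where
  slope := by simpa using congrArg f h.slope
  third := by simpa [map_ofNat] using congrArg f h.third
  line := by simpa using congrArg f h.line
  negz := by simpa using congrArg f h.negz
  negw := by simpa using congrArg f h.negw

/-- The sum of the `z`-coordinates of the points of a curve on the line `y = m x + c`. -/
lemma sum_z_of_line {F : Type*} [Field F] {a₁ a₂ a₃ a₄ a₆ x₁ x₂ x₃ y₁ y₂ y₃ m c ν l z₁ z₂ z₃ : F}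
    (e1 : x₁ + x₂ + x₃ = m ^ 2 + a₁ * m - a₂)
    (e2 : x₁ * x₂ + x₁ * x₃ + x₂ * x₃ = a₄ - 2 * m * c - a₁ * c - a₃ * m)
    (e3 : x₁ * x₂ * x₃ = c ^ 2 + a₃ * c - a₆)
    (hy₁ : y₁ = m * x₁ + c) (hy₂ : y₂ = m * x₂ + c) (hy₃ : y₃ = m * x₃ + c)
    (hz₁ : x₁ = z₁ * y₁) (hz₂ : x₂ = z₂ * y₂) (hz₃ : x₃ = z₃ * y₃)
    (hν : ν * c = 1) (hl : ν * m + l = 0) :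
    (1 + a₂ * l + a₄ * l ^ 2 + a₆ * l ^ 3) * (z₁ + z₂ + z₃) =
      a₁ * l + a₃ * l ^ 2 - a₂ * ν - 2 * a₄ * l * ν - 3 * a₆ * l ^ 2 * ν := by
  have hc : c ≠ 0 := right_ne_zero_of_mul_eq_one hν
  have hl' : l = -m / c := by
    rw [eq_div_iff hc]; linear_combination c * hl - m * hν
  have hν' : ν = 1 / c := by rw [eq_div_iff hc, hν]
  -- The sum of zᵢ = xᵢ/yᵢ is a quotient with denominator y₁y₂y₃. Numerator and denominator are
  -- symmetric in the xᵢ along the line, hence known from `e1`, `e2`, `e3`.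
  have hA : (1 + a₂ * l + a₄ * l ^ 2 + a₆ * l ^ 3) * c ^ 3 = y₁ * y₂ * y₃ := by
    have : y₁ * y₂ * y₃ = m ^ 3 * (x₁ * x₂ * x₃) + m ^ 2 * c * (x₁ * x₂ + x₁ * x₃ + x₂ * x₃)
        + m * c ^ 2 * (x₁ + x₂ + x₃) + c ^ 3 := by rw [hy₁, hy₂, hy₃]; ring
    rw [this, e1, e2, e3, hl']
    field_simp
    ring
  have hB : (a₁ * l + a₃ * l ^ 2 - a₂ * ν - 2 * a₄ * l * ν - 3 * a₆ * l ^ 2 * ν) * c ^ 3 =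
      x₁ * y₂ * y₃ + x₂ * y₁ * y₃ + x₃ * y₁ * y₂ := by
    have : x₁ * y₂ * y₃ + x₂ * y₁ * y₃ + x₃ * y₁ * y₂ =
        3 * m ^ 2 * (x₁ * x₂ * x₃) + 2 * m * c * (x₁ * x₂ + x₁ * x₃ + x₂ * x₃)
        + c ^ 2 * (x₁ + x₂ + x₃) := by rw [hy₁, hy₂, hy₃]; ring
    rw [this, e1, e2, e3, hl', hν']
    field_simp
    ring
  apply mul_right_cancel₀ (pow_ne_zero 3 hc)
  rw [hB]
  linear_combination (z₁ + z₂ + z₃) * hA - y₂ * y₃ * hz₁ - y₁ * y₃ * hz₂ - y₁ * y₂ * hz₃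

section Coordinates

variable {R : Type*} [CommRing R] {K : Type*} [Field K] [Algebra R K]

/-- `(z, w)` are the coordinates `z = x / y` and `w = 1 / y` of the point `P`. -/
def HasCoords {W : WeierstrassCurve R} : (W.baseChange K).toAffine.Point → R → R → Prop
  | .zero, z, w => z = 0 ∧ w = 0
  | .some x y _, z, w => x = algebraMap R K z * y ∧ algebraMap R K w * y = 1

variable {W : WeierstrassCurve R}

lemma hasCoords_zero : HasCoords (0 : (W.baseChange K).toAffine.Point) 0 0 := ⟨rfl, rfl⟩

lemma HasCoords.eq_zero {z w : R} (h : HasCoords (0 : (W.baseChange K).toAffine.Point) z w) :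
    z = 0 ∧ w = 0 := h

lemma HasCoords.unique (hinj : Function.Injective (algebraMap R K))
    {P : (W.baseChange K).toAffine.Point} {z w z' w' : R} (h : HasCoords P z w)
    (h' : HasCoords P z' w') : z = z' ∧ w = w' := by
  rcases P with _ | ⟨x, y, hP⟩
  · exact ⟨h.1.trans h'.1.symm, h.2.trans h'.2.symm⟩
  · have hy : y ≠ 0 := right_ne_zero_of_mul_eq_one h.2
    exact ⟨hinj (mul_right_cancel₀ hy (h.1.symm.trans h'.1)),
      hinj (mul_right_cancel₀ hy (h.2.trans h'.2.symm))⟩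

lemma HasCoords.w_ne_zero {x y : K} {h : (W.baseChange K).toAffine.Nonsingular x y} {z w : R}
    (hP : HasCoords (.some x y h) z w) : w ≠ 0 := by
  rintro rfl
  simpa using hP.2

lemma HasCoords.ext {P Q : (W.baseChange K).toAffine.Point} {z w : R} (hP : HasCoords P z w)
    (hQ : HasCoords Q z w) : P = Q := by
  rcases P with _ | ⟨x, y, h⟩ <;> rcases Q with _ | ⟨x', y', h'⟩
  · rfl
  · exact absurd hP.2 hQ.w_ne_zero
  · exact absurd hQ.2 hP.w_ne_zero
  · have hw : algebraMap R K w ≠ 0 := left_ne_zero_of_mul_eq_one hP.2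
    have hy : y = y' := mul_left_cancel₀ hw (hP.2.trans hQ.2.symm)
    have hx : x = x' := by rw [hP.1, hQ.1, hy]
    subst hx hy
    rfl

lemma HasCoords.curveEq (hinj : Function.Injective (algebraMap R K))
    {P : (W.baseChange K).toAffine.Point} {z w : R} (hP : HasCoords P z w) : CurveEq W z w := by
  rcases P with _ | ⟨x, y, h⟩
  · obtain ⟨rfl, rfl⟩ := hP
    simp [CurveEq]
  · obtain ⟨hx, hy⟩ := hP
    have hE := h.1
    rw [WeierstrassCurve.Affine.equation_iff] at hE
    simp only [WeierstrassCurve.toAffine, WeierstrassCurve.baseChange, WeierstrassCurve.map_a₁,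
      WeierstrassCurve.map_a₂, WeierstrassCurve.map_a₃, WeierstrassCurve.map_a₄,
      WeierstrassCurve.map_a₆] at hE
    apply hinj
    simp only [map_add, map_mul, map_pow]
    have hy0 : y ≠ 0 := right_ne_zero_of_mul_eq_one hy
    have hw : algebraMap R K w = y⁻¹ := eq_inv_of_mul_eq_one_left hy
    have hz : algebraMap R K z = x * y⁻¹ := by rw [hx]; field_simp
    rw [hw, hz]
    field_simp
    linear_combination hE

lemma exists_hasCoords_of_curveEq [(W.baseChange K).IsElliptic]
    (hinj : Function.Injective (algebraMap R K)) {z w : R} (h : CurveEq W z w) (hw : w ≠ 0) :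
    ∃ P : (W.baseChange K).toAffine.Point, HasCoords P z w := by
  have hw' : algebraMap R K w ≠ 0 := (map_ne_zero_iff _ hinj).2 hw
  have hE : (W.baseChange K).toAffine.Equation (algebraMap R K z * (algebraMap R K w)⁻¹)
      (algebraMap R K w)⁻¹ := by
    rw [WeierstrassCurve.Affine.equation_iff]
    simp only [WeierstrassCurve.toAffine, WeierstrassCurve.baseChange, WeierstrassCurve.map_a₁,
      WeierstrassCurve.map_a₂, WeierstrassCurve.map_a₃, WeierstrassCurve.map_a₄,
      WeierstrassCurve.map_a₆]
    have := congrArg (algebraMap R K) h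
    simp only [map_add, map_mul, map_pow] at this
    field_simp
    linear_combination this
  exact ⟨.some _ _ (WeierstrassCurve.Affine.equation_iff_nonsingular.1 hE), rfl,
    mul_inv_cancel₀ hw'⟩

variable [IsLocalRing R]

/-- This and the next two lemmas cover all denominators of the chord formulas: each is 1 plus a
combination of the aᵢ, so no chord, tangent or inverse leaves the integral chart. -/
lemma isUnit_neg_denom (hW : CoeffsInMaximalIdeal W) (z w : R) :
    IsUnit (1 + W.a₁ * z + W.a₃ * w) := by
  apply isUnit_of_sub_mem
  have : 1 + W.a₁ * z + W.a₃ * w - 1 = W.a₁ * z + W.a₃ * w := by ring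
  rw [this]
  exact add_mem (Ideal.mul_mem_right _ _ hW.a₁) (Ideal.mul_mem_right _ _ hW.a₃)

lemma isUnit_slope_denom (hW : CoeffsInMaximalIdeal W) (z₁ w₁ w₂ : R) :
    IsUnit (1 + W.a₁ * z₁ + W.a₃ * (w₁ + w₂) - W.a₂ * z₁ ^ 2
      - W.a₄ * (z₁ * (w₁ + w₂)) - W.a₆ * (w₁ ^ 2 + w₁ * w₂ + w₂ ^ 2)) := by
  apply isUnit_of_sub_mem
  have : 1 + W.a₁ * z₁ + W.a₃ * (w₁ + w₂) - W.a₂ * z₁ ^ 2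
    - W.a₄ * (z₁ * (w₁ + w₂)) - W.a₆ * (w₁ ^ 2 + w₁ * w₂ + w₂ ^ 2) - 1 =
    W.a₁ * z₁ + W.a₃ * (w₁ + w₂) - W.a₂ * z₁ ^ 2
    - W.a₄ * (z₁ * (w₁ + w₂)) - W.a₆ * (w₁ ^ 2 + w₁ * w₂ + w₂ ^ 2) := by ring
  rw [this]
  refine sub_mem (sub_mem (sub_mem (add_mem ?_ ?_) ?_) ?_) ?_ <;> apply Ideal.mul_mem_right
  exacts [hW.a₁, hW.a₃, hW.a₂, hW.a₄, hW.a₆]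

lemma isUnit_third_denom (hW : CoeffsInMaximalIdeal W) (l : R) :
    IsUnit (1 + W.a₂ * l + W.a₄ * l ^ 2 + W.a₆ * l ^ 3) := by
  apply isUnit_of_sub_mem
  have : 1 + W.a₂ * l + W.a₄ * l ^ 2 + W.a₆ * l ^ 3 - 1 =
    W.a₂ * l + W.a₄ * l ^ 2 + W.a₆ * l ^ 3 := by ring
  rw [this]
  refine add_mem (add_mem ?_ ?_) ?_ <;> apply Ideal.mul_mem_right
  exacts [hW.a₂, hW.a₄, hW.a₆]

lemma hasNonsingularReduction_iff_exists_hasCoords (hW : CoeffsInMaximalIdeal W)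
    (hinj : Function.Injective (algebraMap R K)) {P : (W.baseChange K).toAffine.Point} :
    HasNonsingularReduction W P ↔ ∃ z w : R, HasCoords P z w := by
  rcases P with _ | ⟨x, y, h⟩
  · exact ⟨fun _ => ⟨0, 0, hasCoords_zero⟩, fun _ => hasNonsingularReduction_zero W⟩
  · exact hasNonsingularReduction_some hW hinj h

/-- Negation fixes x and multiplies y by the unit -(1 + a₁z + a₃w), so z and w are both divided by
it. -/
lemma HasCoords.neg (hW : CoeffsInMaximalIdeal W) {P : (W.baseChange K).toAffine.Point} {z w : R}
    (hP : HasCoords P z w) : ∃ z' w' : R, HasCoords (-P) z' w' ∧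
      (1 + W.a₁ * z + W.a₃ * w) * z' = -z ∧ (1 + W.a₁ * z + W.a₃ * w) * w' = -w := by
  rcases P with _ | ⟨x, y, h⟩
  · obtain ⟨rfl, rfl⟩ := hP
    exact ⟨0, 0, hasCoords_zero, by simp, by simp⟩
  · obtain ⟨hx, hy⟩ := hP
    obtain ⟨u, hu⟩ := isUnit_neg_denom hW z w
    have huu : (u : R) * ↑u⁻¹ = 1 := by simp
    have hinv : algebraMap R K (↑u⁻¹) *
        (1 + algebraMap R K W.a₁ * algebraMap R K z + algebraMap R K W.a₃ * algebraMap R K w)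
          = 1 := by
      simp only [← map_mul, ← map_add, ← map_one (algebraMap R K), ← hu]
      simp
    have hn : (W.baseChange K).toAffine.negY x y =
        -(1 + algebraMap R K W.a₁ * algebraMap R K z + algebraMap R K W.a₃ * algebraMap R K w)
          * y := by
      simp only [WeierstrassCurve.Affine.negY, WeierstrassCurve.toAffine,
        WeierstrassCurve.baseChange, WeierstrassCurve.map_a₁, WeierstrassCurve.map_a₃]
      linear_combination (-algebraMap R K W.a₁) * hx + algebraMap R K W.a₃ * hy
    rw [WeierstrassCurve.Affine.Point.neg_some]
    refine ⟨-z * ↑u⁻¹, -w * ↑u⁻¹, ⟨?_, ?_⟩, ?_, ?_⟩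
    · rw [hn, map_mul, map_neg]
      linear_combination hx - algebraMap R K z * y * hinv
    · rw [hn, map_mul, map_neg]
      linear_combination hy + algebraMap R K w * y * hinv
    · rw [← hu]; linear_combination -z * huu
    · rw [← hu]; linear_combination -w * huu

/-- On a line `w = l z` through the origin, the two other points `(z, w)` and `(z', w')` of the
curve are inverse to each other. -/
lemma third_of_line_through_zero [IsDomain R] (hW : CoeffsInMaximalIdeal W) {z w z' l : R}
    (hz : z ≠ 0) (hc : CurveEq W z w) (hl : l * z = w)
    (h : (1 + W.a₁ * z + W.a₃ * w) * z' = -z) :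
    (1 + W.a₂ * l + W.a₄ * l ^ 2 + W.a₆ * l ^ 3) * (z + z') = W.a₁ * l + W.a₃ * l ^ 2 := by
  apply mul_left_cancel₀ (isUnit_neg_denom hW z w).ne_zero
  apply mul_left_cancel₀ hz
  subst hl
  unfold CurveEq at hc
  linear_combination (1 + W.a₂ * l + W.a₄ * l ^ 2 + W.a₆ * l ^ 3) * z * h
    - (W.a₁ + W.a₃ * l) * hc

/-- The chord from the origin to Q meets the curve again at -Q. This and the next two lemmas check
the formulas in the cases where a point of the chord is the origin, which the affine x, y addition
law does not see. -/
lemma isChordSum_zero_left [IsDomain R] (hW : CoeffsInMaximalIdeal W)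
    (hinj : Function.Injective (algebraMap R K))
    {Q : (W.baseChange K).toAffine.Point} {z₂ w₂ : R} (hQ : HasCoords Q z₂ w₂) :
    ∃ l z₃ w₃, IsChordSum W 0 0 z₂ w₂ l z₃ w₃ z₂ w₂ := by
  obtain ⟨z₃, w₃, h₃, hz₃, hw₃⟩ := hQ.neg hW
  obtain ⟨z₄, w₄, h₄, hz₄, hw₄⟩ := h₃.neg hW
  rw [neg_neg] at h₄
  obtain ⟨rfl, rfl⟩ := h₄.unique hinj hQ
  have hc := hQ.curveEq hinj
  obtain ⟨u, hu⟩ := isUnit_slope_denom hW 0 0 w₄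
  obtain ⟨l, hl⟩ : ∃ l : R, ↑u * l = -(W.a₁ * w₄) + 0 ^ 2 + 0 * z₄ + z₄ ^ 2 + W.a₂ * w₄ * (0 + z₄)
      + W.a₄ * w₄ ^ 2 := ⟨↑u⁻¹ * _, by rw [← mul_assoc, Units.mul_inv, one_mul]⟩
  -- With one point at the origin, the slope formula is the curve equation divided by z.
  have hlz : l * z₄ = w₄ := by
    apply mul_left_cancel₀ u.ne_zero
    rw [← mul_assoc, hl, hu]
    unfold CurveEq at hc
    linear_combination -hc
  refine ⟨l, z₃, w₃, hu ▸ hl, ?_, ?_, hz₄, hw₄⟩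
  · by_cases hz : z₄ = 0
    · subst hz
      have hw : w₄ = 0 := by rw [← hlz, mul_zero]
      subst hw
      have hl0 : l = 0 := by
        apply mul_left_cancel₀ u.ne_zero
        rw [hl]; ring
      have hz₃' : z₃ = 0 := by
        apply mul_left_cancel₀ (isUnit_neg_denom hW 0 0).ne_zero
        rw [hz₃]; simp
      rw [hl0, hz₃']; ring
    · linear_combination third_of_line_through_zero hW hz hc hlz hz₃
  · apply mul_left_cancel₀ (isUnit_neg_denom hW z₄ w₄).ne_zero
    linear_combination hw₃ - l * hz₃ + hlz

lemma isChordSum_zero_right [IsDomain R] (hW : CoeffsInMaximalIdeal W)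
    (hinj : Function.Injective (algebraMap R K))
    {P : (W.baseChange K).toAffine.Point} {z₁ w₁ : R} (hP : HasCoords P z₁ w₁) :
    ∃ l z₃ w₃, IsChordSum W z₁ w₁ 0 0 l z₃ w₃ z₁ w₁ := by
  obtain ⟨z₃, w₃, h₃, hz₃, hw₃⟩ := hP.neg hW
  obtain ⟨z₄, w₄, h₄, hz₄, hw₄⟩ := h₃.neg hW
  rw [neg_neg] at h₄
  obtain ⟨rfl, rfl⟩ := h₄.unique hinj hP
  have hc := hP.curveEq hinj
  obtain ⟨u, hu⟩ := isUnit_slope_denom hW z₄ w₄ 0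
  obtain ⟨l, hl⟩ : ∃ l : R, ↑u * l = -(W.a₁ * 0) + z₄ ^ 2 + z₄ * 0 + 0 ^ 2 + W.a₂ * 0 * (z₄ + 0)
      + W.a₄ * 0 ^ 2 := ⟨↑u⁻¹ * _, by rw [← mul_assoc, Units.mul_inv, one_mul]⟩
  have hlz : l * z₄ = w₄ := by
    apply mul_left_cancel₀ u.ne_zero
    rw [← mul_assoc, hl, hu]
    unfold CurveEq at hc
    linear_combination -hc
  refine ⟨l, z₃, w₃, hu ▸ hl, ?_, ?_, hz₄, hw₄⟩
  · by_cases hz : z₄ = 0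
    · subst hz
      have hw : w₄ = 0 := by rw [← hlz, mul_zero]
      subst hw
      have hl0 : l = 0 := by
        apply mul_left_cancel₀ u.ne_zero
        rw [hl]; ring
      have hz₃' : z₃ = 0 := by
        apply mul_left_cancel₀ (isUnit_neg_denom hW 0 0).ne_zero
        rw [hz₃]; simp
      rw [hl0, hz₃']; ring
    · linear_combination third_of_line_through_zero hW hz hc hlz hz₃ - (W.a₂ + 2 * W.a₄ * l
        + 3 * W.a₆ * l ^ 2) * hlz
  · apply mul_left_cancel₀ (isUnit_neg_denom hW z₄ w₄).ne_zero
    linear_combination hw₃ - l * hz₃ + (W.a₁ * z₄ + W.a₃ * w₄ + 2) * hlz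

lemma isChordSum_neg [IsDomain R] (hW : CoeffsInMaximalIdeal W) {z₁ w₁ z₂ w₂ : R}
    (hz₁ : z₁ ≠ 0) (hc : CurveEq W z₁ w₁) (hz : (1 + W.a₁ * z₁ + W.a₃ * w₁) * z₂ = -z₁)
    (hw : (1 + W.a₁ * z₁ + W.a₃ * w₁) * w₂ = -w₁) :
    ∃ l, IsChordSum W z₁ w₁ z₂ w₂ l 0 0 0 0 := by
  obtain ⟨u, hu⟩ := isUnit_slope_denom hW z₁ w₁ w₂
  obtain ⟨l, hl⟩ : ∃ l : R, ↑u * l = -(W.a₁ * w₂) + z₁ ^ 2 + z₁ * z₂ + z₂ ^ 2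
      + W.a₂ * w₂ * (z₁ + z₂) + W.a₄ * w₂ ^ 2 :=
    ⟨↑u⁻¹ * _, by rw [← mul_assoc, Units.mul_inv, one_mul]⟩
  -- The chord through P and -P passes through the origin. Multiplying by e², with e = 1 + a₁z₁ +
  -- a₃w₁, eliminates z₂ and w₂, and what is left is a multiple of the curve equation.
  have hlz : l * z₁ = w₁ := by
    obtain ⟨v, hv⟩ := isUnit_neg_denom hW z₁ w₁
    rw [← hv] at hz hw
    apply mul_left_cancel₀ u.ne_zero
    apply mul_left_cancel₀ (pow_ne_zero 2 v.ne_zero)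
    rw [← mul_assoc (u : R), hl, hu]
    generalize (v : R) = e at *
    have hV : e ^ 2 * (-(W.a₁ * w₂) + z₁ ^ 2 + z₁ * z₂ + z₂ ^ 2 + W.a₂ * w₂ * (z₁ + z₂)
        + W.a₄ * w₂ ^ 2) = W.a₁ * w₁ * e + z₁ ^ 2 * e ^ 2 - z₁ ^ 2 * e + z₁ ^ 2
        - W.a₂ * w₁ * z₁ * (e - 1) + W.a₄ * w₁ ^ 2 := by
      linear_combination (-W.a₁ * e + W.a₂ * (e * z₁ + e * z₂) + W.a₄ * (e * w₂ - w₁)) * hw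
        + (e * z₁ + (e * z₂ - z₁) - W.a₂ * w₁) * hz
    have hU : e ^ 2 * (1 + W.a₁ * z₁ + W.a₃ * (w₁ + w₂) - W.a₂ * z₁ ^ 2
        - W.a₄ * (z₁ * (w₁ + w₂)) - W.a₆ * (w₁ ^ 2 + w₁ * w₂ + w₂ ^ 2)) =
        e ^ 2 * (1 + W.a₁ * z₁) + W.a₃ * (e ^ 2 * w₁ - e * w₁) - W.a₂ * z₁ ^ 2 * e ^ 2
        - W.a₄ * z₁ * (e ^ 2 * w₁ - e * w₁)
        - W.a₆ * (e ^ 2 * w₁ ^ 2 - e * w₁ ^ 2 + w₁ ^ 2) := by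
      linear_combination (W.a₃ * e - W.a₄ * z₁ * e - W.a₆ * e * w₁ - W.a₆ * (e * w₂ - w₁)) * hw
    unfold CurveEq at hc
    linear_combination z₁ * hV - w₁ * hU - (e ^ 2 - e + 1) * hc - w₁ * hv
  refine ⟨l, hu ▸ hl, ?_, by rw [hlz]; ring, by simp, by simp⟩
  linear_combination third_of_line_through_zero hW hz₁ hc hlz hz - (W.a₂ + 2 * W.a₄ * l
        + 3 * W.a₆ * l ^ 2) * hlz

-- The slope formula does not divide by z₁ - z₂, so distinct and coincident points obey the same
-- identities, which can then be pushed through any ring homomorphism. The work is to match them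
-- with the case distinctions in the affine group law.
set_option linter.overlappingInstances false in
lemma HasCoords.add [IsDomain R] [ValuationRing R] [IsFractionRing R K]
    [DecidableEq K] (hW : CoeffsInMaximalIdeal W)
    {P Q : (W.baseChange K).toAffine.Point} {z₁ w₁ z₂ w₂ : R} (hP : HasCoords P z₁ w₁)
    (hQ : HasCoords Q z₂ w₂) :
    ∃ l z₃ w₃ z w, HasCoords (P + Q) z w ∧ IsChordSum W z₁ w₁ z₂ w₂ l z₃ w₃ z w := by
  have hinj := IsFractionRing.injective R K
  rcases P with _ | ⟨x₁, y₁, h₁⟩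
  · obtain ⟨rfl, rfl⟩ := hP
    obtain ⟨l, z₃, w₃, h⟩ := isChordSum_zero_left hW hinj hQ
    rw [← WeierstrassCurve.Affine.Point.zero_def, zero_add]
    exact ⟨l, z₃, w₃, z₂, w₂, hQ, h⟩
  rcases Q with _ | ⟨x₂, y₂, h₂⟩
  · obtain ⟨rfl, rfl⟩ := hQ
    obtain ⟨l, z₃, w₃, h⟩ := isChordSum_zero_right hW hinj hP
    rw [← WeierstrassCurve.Affine.Point.zero_def, add_zero]
    exact ⟨l, z₃, w₃, z₁, w₁, hP, h⟩
  have c₁ := hP.curveEq hinj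
  have c₂ := hQ.curveEq hinj
  by_cases hxy : x₁ = x₂ ∧ y₁ = (W.baseChange K).toAffine.negY x₂ y₂
  · obtain ⟨z₄, w₄, h₄, hz₄, hw₄⟩ := hP.neg hW
    have hPQ : WeierstrassCurve.Affine.Point.some x₁ y₁ h₁ + .some x₂ y₂ h₂ = 0 :=
      WeierstrassCurve.Affine.Point.add_of_Y_eq hxy.1 hxy.2
    rw [neg_eq_of_add_eq_zero_right hPQ] at h₄
    obtain ⟨rfl, rfl⟩ := h₄.unique hinj hQ
    -- On the curve z = 0 forces w = 0, and an affine point has w ≠ 0.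
    have hz₁ : z₁ ≠ 0 := by
      rintro rfl
      obtain ⟨u, hu⟩ := isUnit_slope_denom hW 0 w₁ 0
      have : u * w₁ = 0 := by
        rw [hu]; unfold CurveEq at c₁; linear_combination c₁
      exact hP.w_ne_zero ((mul_eq_zero.1 this).resolve_left u.ne_zero)
    obtain ⟨l, h⟩ := isChordSum_neg hW hz₁ c₁ hz₄ hw₄
    exact ⟨l, 0, 0, 0, 0, hPQ ▸ hasCoords_zero, h⟩
  rw [WeierstrassCurve.Affine.Point.add_some hxy]
  obtain ⟨hx₁, hy₁⟩ := hP
  obtain ⟨hx₂, hy₂⟩ := hQ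
  have hE₁ := h₁.1
  have hE₂ := h₂.1
  rw [WeierstrassCurve.Affine.equation_iff] at hE₁ hE₂
  simp only [WeierstrassCurve.toAffine, WeierstrassCurve.baseChange, WeierstrassCurve.map_a₁,
    WeierstrassCurve.map_a₂, WeierstrassCurve.map_a₃, WeierstrassCurve.map_a₄,
    WeierstrassCurve.map_a₆] at hE₁ hE₂
  obtain ⟨u, hu⟩ := isUnit_slope_denom hW z₁ w₁ w₂
  set V := -(W.a₁ * w₂) + z₁ ^ 2 + z₁ * z₂ + z₂ ^ 2 + W.a₂ * w₂ * (z₁ + z₂) + W.a₄ * w₂ ^ 2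
    with hV
  obtain ⟨l, hl⟩ : ∃ l : R, ↑u * l = V :=
    ⟨↑u⁻¹ * _, by rw [← mul_assoc, Units.mul_inv, one_mul]⟩
  -- Subtracting the two curve equations gives u (w₁ - w₂) = V (z₁ - z₂).
  have hdiff : w₁ - w₂ = l * (z₁ - z₂) := by
    apply mul_left_cancel₀ u.ne_zero
    rw [← mul_assoc, hl, hu, hV]
    unfold CurveEq at c₁ c₂
    linear_combination c₁ - c₂
  have line₁ : algebraMap R K (w₁ - l * z₁) * y₁ + algebraMap R K l * x₁ = 1 := by
    rw [map_sub, map_mul]; linear_combination hy₁ + algebraMap R K l * hx₁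
  have line₂ : algebraMap R K (w₁ - l * z₁) * y₂ + algebraMap R K l * x₂ = 1 := by
    have e : w₁ - l * z₁ = w₂ - l * z₂ := by linear_combination hdiff
    rw [e, map_sub, map_mul]; linear_combination hy₂ + algebraMap R K l * hx₂
  -- The line w = l z + ν becomes ν y + l x = 1 with ν = w₁ - l z₁; this compares its slope with the
  -- affine one. For a tangent, V y₁² is the numerator of the affine slope.
  have hslope : algebraMap R K (w₁ - l * z₁) * (W.baseChange K).toAffine.slope x₁ x₂ y₁ y₂
      + algebraMap R K l = 0 := by
    by_cases hx : x₁ = x₂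
    · have hyn : y₁ ≠ (W.baseChange K).toAffine.negY x₂ y₂ := fun h => hxy ⟨hx, h⟩
      have hyy : y₁ = y₂ := WeierstrassCurve.Affine.Y_eq_of_Y_ne h₁.1 h₂.1 hx hyn
      rw [WeierstrassCurve.Affine.slope_of_Y_ne hx hyn]
      subst hx hyy
      have hy0 : y₁ ≠ 0 := right_ne_zero_of_mul_eq_one hy₁
      have hw : algebraMap R K w₁ = y₁⁻¹ := eq_inv_of_mul_eq_one_left hy₁
      have hw₂ : algebraMap R K w₂ = y₁⁻¹ := eq_inv_of_mul_eq_one_left hy₂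
      have hz : algebraMap R K z₁ = x₁ * y₁⁻¹ := by rw [eq_mul_inv_iff_mul_eq₀ hy0, ← hx₁]
      have hz₂ : algebraMap R K z₂ = x₁ * y₁⁻¹ := by rw [eq_mul_inv_iff_mul_eq₀ hy0, ← hx₂]
      have hD : y₁ - (W.baseChange K).toAffine.negY x₁ y₁ ≠ 0 := sub_ne_zero.2 hyn
      have hlK : algebraMap R K (u : R) * algebraMap R K l = algebraMap R K V := by
        rw [← map_mul, hl]
      have hVK : algebraMap R K V * y₁ ^ 2 = 3 * x₁ ^ 2 + 2 * algebraMap R K W.a₂ * x₁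
          + algebraMap R K W.a₄ - algebraMap R K W.a₁ * y₁ := by
        rw [hV]
        simp only [map_add, map_mul, map_pow, map_neg, hw₂, hz, hz₂]
        field_simp
        ring
      have hUK : algebraMap R K (u : R) * y₁ ^ 2 = y₁ ^ 2 + algebraMap R K W.a₁ * x₁ * y₁
          + 2 * algebraMap R K W.a₃ * y₁ - algebraMap R K W.a₂ * x₁ ^ 2
          - 2 * algebraMap R K W.a₄ * x₁ - 3 * algebraMap R K W.a₆ := by
        rw [hu]
        simp only [map_add, map_sub, map_mul, map_pow, map_one, hw, hw₂, hz]
        field_simp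
        ring
      simp only [WeierstrassCurve.Affine.negY, WeierstrassCurve.toAffine,
        WeierstrassCurve.baseChange, WeierstrassCurve.map_a₁, WeierstrassCurve.map_a₂,
        WeierstrassCurve.map_a₃, WeierstrassCurve.map_a₄] at hD ⊢
      rw [← hVK, map_sub, map_mul, hw, hz, ← hlK]
      generalize algebraMap R K l = L at *
      generalize algebraMap R K (u : R) = U at *
      rw [← hlK] at hVK
      rw [mul_div_assoc', div_add' _ _ _ hD, div_eq_zero_iff]
      left
      field_simp
      apply mul_left_cancel₀ hy0
      linear_combination L * (hUK - x₁ * hVK + 3 * hE₁)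
    · rw [WeierstrassCurve.Affine.slope_of_X_ne hx]
      have hD : x₁ - x₂ ≠ 0 := sub_ne_zero.2 hx
      field_simp
      linear_combination line₁ - line₂
  set m := (W.baseChange K).toAffine.slope x₁ x₂ y₁ y₂ with hm
  set x₃ := (W.baseChange K).toAffine.addX x₁ x₂ m with hx₃'
  set y₃ := (W.baseChange K).toAffine.negAddY x₁ x₂ y₁ m with hy₃'
  have h₃ : (W.baseChange K).toAffine.Nonsingular x₃ y₃ :=
    WeierstrassCurve.Affine.nonsingular_negAdd h₁ h₂ hxy
  have hy₃m : y₃ = m * (x₃ - x₁) + y₁ := rfl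
  have line₃ : algebraMap R K (w₁ - l * z₁) * y₃ + algebraMap R K l * x₃ = 1 := by
    rw [hy₃m]
    linear_combination line₁ + (x₃ - x₁) * hslope
  obtain ⟨z₃, w₃, hx₃, hy₃⟩ := exists_integral_of_line hW h₃.1 line₃
  obtain ⟨z, w, h, hz, hw⟩ := HasCoords.neg (P := .some x₃ y₃ h₃) hW ⟨hx₃, hy₃⟩
  refine ⟨l, z₃, w₃, z, w, h, hu ▸ hl, ?_, ?_, hz, hw⟩
  · set c := y₁ - m * x₁ with hc
    have hν : algebraMap R K (w₁ - l * z₁) * c = 1 := by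
      rw [hc]; linear_combination line₁ - x₁ * hslope
    -- Vieta for the cubic cut out by the line: its lower coefficients give the second and third
    -- symmetric functions of the xᵢ, while the first comes from the definition of `addX`.
    have hpoly := WeierstrassCurve.Affine.addPolynomial_slope h₁.1 h₂.1 hxy
    rw [WeierstrassCurve.Affine.addPolynomial_eq, neg_inj, Cubic.prod_X_sub_C_eq,
      Cubic.toPoly_injective] at hpoly
    have e2 := congrArg Cubic.c hpoly
    have e3 := congrArg Cubic.d hpoly
    simp only [← hm, ← hx₃'] at e2 e3
    have e1 : x₁ + x₂ + x₃ = m ^ 2 + algebraMap R K W.a₁ * m - algebraMap R K W.a₂ := by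
      rw [hx₃', WeierstrassCurve.Affine.addX]
      simp only [WeierstrassCurve.toAffine, WeierstrassCurve.baseChange, WeierstrassCurve.map_a₁,
        WeierstrassCurve.map_a₂]
      ring
    simp only [WeierstrassCurve.toAffine, WeierstrassCurve.baseChange, WeierstrassCurve.map_a₁,
      WeierstrassCurve.map_a₃, WeierstrassCurve.map_a₄, WeierstrassCurve.map_a₆] at e2 e3
    have hy₂' : y₂ = m * x₂ + c := by
      apply mul_left_cancel₀ (left_ne_zero_of_mul_eq_one hν)
      linear_combination line₂ - x₂ * hslope - hν
    have key := sum_z_of_line (a₄ := algebraMap R K W.a₄) (a₆ := algebraMap R K W.a₆)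
      (a₃ := algebraMap R K W.a₃) e1 (by rw [hc]; linear_combination -e2)
      (by rw [hc]; linear_combination e3) (by rw [hc]; ring) hy₂' (by rw [hy₃m, hc]; ring)
      hx₁ hx₂ hx₃ hν hslope
    apply hinj
    simpa [map_ofNat] using key
  · apply hinj
    have hy0 : y₃ ≠ 0 := right_ne_zero_of_mul_eq_one hy₃
    apply mul_right_cancel₀ hy0
    rw [hy₃, map_add, map_mul]
    linear_combination -line₃ + algebraMap R K l * hx₃

end Coordinates

/-! ### Congruences for the group law -/

section Algebra

variable {S : Type*} [CommRing S] {W : WeierstrassCurve S}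

/-- The difference of the two equations is w - w' times the bracket. Since S is arbitrary, this also
applies modulo an ideal. -/
lemma CurveEq.w_unique {z w w' : S} (h : CurveEq W z w) (h' : CurveEq W z w')
    (hu : IsUnit (1 + W.a₁ * z + W.a₃ * (w + w') - W.a₂ * z ^ 2
      - W.a₄ * (z * (w + w')) - W.a₆ * (w ^ 2 + w * w' + w' ^ 2))) : w = w' := by
  apply sub_eq_zero.1
  apply hu.mul_left_cancel
  unfold CurveEq at h h'
  linear_combination h - h'

/-- With unit denominators the equations determine l, z₃, w₃ and z one after the other. -/
lemma IsChordSum.unique {z₁ w₁ z₂ w₂ l z₃ w₃ z w l' z₃' w₃' z' w' : S}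
    (h : IsChordSum W z₁ w₁ z₂ w₂ l z₃ w₃ z w) (h' : IsChordSum W z₁ w₁ z₂ w₂ l' z₃' w₃' z' w')
    (hu : IsUnit (1 + W.a₁ * z₁ + W.a₃ * (w₁ + w₂) - W.a₂ * z₁ ^ 2
      - W.a₄ * (z₁ * (w₁ + w₂)) - W.a₆ * (w₁ ^ 2 + w₁ * w₂ + w₂ ^ 2)))
    (hA : IsUnit (1 + W.a₂ * l + W.a₄ * l ^ 2 + W.a₆ * l ^ 3))
    (he : IsUnit (1 + W.a₁ * z₃ + W.a₃ * w₃)) : z = z' := by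
  obtain rfl : l = l' := hu.mul_left_cancel (h.slope.trans h'.slope.symm)
  obtain rfl : z₃ = z₃' := add_left_cancel (hA.mul_left_cancel (h.third.trans h'.third.symm))
  obtain rfl : w₃ = w₃' := h.line.trans h'.line.symm
  exact he.mul_left_cancel (h.negz.trans h'.negz.symm)

/-- The curve equation reads (unit) · w = z³. The bracket is the slope denominator at second point
w₂ = 0, hence its unsimplified form. -/
lemma CurveEq.pow_three_dvd {z w : S} (h : CurveEq W z w)
    (hu : IsUnit (1 + W.a₁ * z + W.a₃ * (w + 0) - W.a₂ * z ^ 2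
      - W.a₄ * (z * (w + 0)) - W.a₆ * (w ^ 2 + w * 0 + 0 ^ 2))) : z ^ 3 ∣ w := by
  refine (hu.dvd_mul_left).1 ⟨1, ?_⟩
  unfold CurveEq at h
  linear_combination h

/-- The coefficients are divisible by `π`. -/
structure CoeffsDvd (π : S) (W : WeierstrassCurve S) : Prop where
  a₁ : π ∣ W.a₁
  a₂ : π ∣ W.a₂
  a₃ : π ∣ W.a₃
  a₄ : π ∣ W.a₄
  a₆ : π ∣ W.a₆

lemma CurveEq.dvd_sub_pow_three {π z w : S} (hW : CoeffsDvd π W) (h : CurveEq W z w) :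
    π ∣ w - z ^ 3 := by
  have : w - z ^ 3 = W.a₂ * (z ^ 2 * w) + W.a₄ * (z * w ^ 2) + W.a₆ * w ^ 3 - W.a₁ * (z * w)
      - W.a₃ * w ^ 2 := by
    unfold CurveEq at h
    linear_combination h
  rw [this]
  refine dvd_sub (dvd_sub (dvd_add (dvd_add ?_ ?_) ?_) ?_) ?_ <;> apply Dvd.dvd.mul_right
  exacts [hW.a₂, hW.a₄, hW.a₆, hW.a₁, hW.a₃]

/-- To second order, the group law on small `z`-coordinates is addition. -/
lemma IsChordSum.dvd_sub_add {π q z₁ w₁ z₂ w₂ l z₃ w₃ z w : S} (hW : CoeffsDvd π W)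
    (h : IsChordSum W z₁ w₁ z₂ w₂ l z₃ w₃ z w)
    (hu : IsUnit (1 + W.a₁ * z₁ + W.a₃ * (w₁ + w₂) - W.a₂ * z₁ ^ 2
      - W.a₄ * (z₁ * (w₁ + w₂)) - W.a₆ * (w₁ ^ 2 + w₁ * w₂ + w₂ ^ 2)))
    (hA : IsUnit (1 + W.a₂ * l + W.a₄ * l ^ 2 + W.a₆ * l ^ 3))
    (he : IsUnit (1 + W.a₁ * z₃ + W.a₃ * w₃))
    (hz₁ : q ∣ z₁) (hz₂ : q ∣ z₂) (hw₁ : z₁ ^ 3 ∣ w₁) (hw₂ : z₂ ^ 3 ∣ w₂) :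
    π * q ^ 2 ∣ z - (z₁ + z₂) := by
  have hw₁' : q ^ 2 ∣ w₁ := ((pow_dvd_pow_of_dvd hz₁ 2).trans (pow_dvd_pow _ (by norm_num))).trans hw₁
  have hw₂' : q ^ 2 ∣ w₂ := ((pow_dvd_pow_of_dvd hz₂ 2).trans (pow_dvd_pow _ (by norm_num))).trans hw₂
  -- The slope numerator is quadratic in the zᵢ, up to terms containing w₂, which is divisible by
  -- z₂³.
  have hl : q ^ 2 ∣ l := by
    rw [← hu.dvd_mul_left, h.slope]
    have h1 : q ^ 2 ∣ z₁ ^ 2 := pow_dvd_pow_of_dvd hz₁ 2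
    have h2 : q ^ 2 ∣ z₂ ^ 2 := pow_dvd_pow_of_dvd hz₂ 2
    have h3 : q ^ 2 ∣ z₁ * z₂ := by rw [pow_two]; exact mul_dvd_mul hz₁ hz₂
    have h4 : q ^ 2 ∣ W.a₁ * w₂ := hw₂'.mul_left _
    have h5 : q ^ 2 ∣ W.a₂ * w₂ * (z₁ + z₂) := (hw₂'.mul_left _).mul_right _
    have h6 : q ^ 2 ∣ W.a₄ * w₂ ^ 2 := (hw₂'.trans (dvd_pow_self _ (by norm_num))).mul_left _
    exact dvd_add (dvd_add (dvd_add (dvd_add (dvd_add h4.neg_right h1) h3) h2) h5) h6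
  have hν : q ^ 2 ∣ w₁ - l * z₁ := dvd_sub hw₁' (hl.mul_right _)
  -- Each term on the right of `third` has a factor aᵢ, giving π, and a factor l or ν, giving q².
  have hσ : π * q ^ 2 ∣ z₁ + z₂ + z₃ := by
    rw [← hA.dvd_mul_left, h.third]
    have h1 : π * q ^ 2 ∣ W.a₁ * l := mul_dvd_mul hW.a₁ hl
    have h2 : π * q ^ 2 ∣ W.a₃ * l ^ 2 :=
      mul_dvd_mul hW.a₃ (hl.trans (dvd_pow_self _ (by norm_num)))
    have h3 : π * q ^ 2 ∣ W.a₂ * (w₁ - l * z₁) := mul_dvd_mul hW.a₂ hν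
    have h4 : π * q ^ 2 ∣ 2 * W.a₄ * l * (w₁ - l * z₁) :=
      mul_dvd_mul ((hW.a₄.mul_left _).mul_right _) hν
    have h5 : π * q ^ 2 ∣ 3 * W.a₆ * l ^ 2 * (w₁ - l * z₁) :=
      mul_dvd_mul ((hW.a₆.mul_left _).mul_right _) hν
    exact dvd_sub (dvd_sub (dvd_sub (dvd_add h1 h2) h3) h4) h5
  have hq : q ∣ z₁ + z₂ + z₃ := ((dvd_pow_self q two_ne_zero).trans (dvd_mul_left _ _)).trans hσ
  have hz₃ : q ∣ z₃ := (dvd_add_right (dvd_add hz₁ hz₂)).1 hq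
  have hw₃ : q ^ 2 ∣ w₃ := by rw [h.line]; exact dvd_add (hl.mul_right _) hν
  have hz : q ∣ z := by rw [← he.dvd_mul_left, h.negz]; exact hz₃.neg_right
  have : z - (z₁ + z₂) = -(z₁ + z₂ + z₃) - (W.a₁ * (z₃ * z) + W.a₃ * (w₃ * z)) := by
    linear_combination h.negz
  rw [this]
  refine dvd_sub hσ.neg_right (dvd_add ?_ ?_)
  · exact mul_dvd_mul hW.a₁ (by rw [pow_two]; exact mul_dvd_mul hz₃ hz)
  · exact mul_dvd_mul hW.a₃ (hw₃.mul_right _)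

/-- The group law modulo `π ^ 2`. -/
lemma IsChordSum.sq_dvd_sub {π z₁ w₁ z₂ w₂ l z₃ w₃ z w : S} (hW : CoeffsDvd π W)
    (h : IsChordSum W z₁ w₁ z₂ w₂ l z₃ w₃ z w)
    (hA : IsUnit (1 + W.a₂ * l + W.a₄ * l ^ 2 + W.a₆ * l ^ 3))
    (hw₁ : π ∣ w₁ - z₁ ^ 3) (hw₂ : π ∣ w₂ - z₂ ^ 3) :
    π ^ 2 ∣ z - (z₁ + z₂ + (W.a₁ * (z₁ * z₂) - W.a₂ * (z₁ * z₂ * (z₁ + z₂))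
      + W.a₃ * (z₁ * z₂ * (2 * z₁ ^ 2 + 3 * z₁ * z₂ + 2 * z₂ ^ 2))
      - 2 * W.a₄ * (z₁ * z₂ * (z₁ + z₂) * (z₁ ^ 2 + z₁ * z₂ + z₂ ^ 2))
      - 3 * W.a₆ * (z₁ * z₂ * (z₁ + z₂) * (z₁ ^ 2 + z₁ * z₂ + z₂ ^ 2) ^ 2))) := by
  obtain ⟨b₁, h₁⟩ := hW.a₁
  obtain ⟨b₂, h₂⟩ := hW.a₂
  obtain ⟨b₃, h₃⟩ := hW.a₃
  obtain ⟨b₄, h₄⟩ := hW.a₄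
  obtain ⟨b₆, h₆⟩ := hW.a₆
  obtain ⟨v₁, hw₁⟩ := hw₁
  obtain ⟨v₂, hw₂⟩ := hw₂
  have hs := h.slope
  have ht := h.third
  have hn := h.negz
  rw [h₁, h₂, h₃, h₄, h₆] at hs
  rw [h₂, h₄, h₆] at hA
  rw [h₁, h₂, h₃, h₄, h₆] at ht
  rw [h₁, h₃] at hn
  rw [h₁, h₂, h₃, h₄, h₆]
  -- Modulo π the chord is that of w = z³: slope L, intercept N, third point (-(z₁ + z₂), -(z₁ +
  -- z₂)³). As every correction carries a coefficient divisible by π, these values modulo π suffice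
  -- for the result modulo π².
  obtain ⟨m, hm⟩ : π ∣ l - (z₁ ^ 2 + z₁ * z₂ + z₂ ^ 2) :=
    ⟨-((b₁ * z₁ + b₃ * (w₁ + w₂) - b₂ * z₁ ^ 2
      - b₄ * (z₁ * (w₁ + w₂)) - b₆ * (w₁ ^ 2 + w₁ * w₂ + w₂ ^ 2)) * l)
      - b₁ * w₂ + b₂ * w₂ * (z₁ + z₂) + b₄ * w₂ ^ 2, by linear_combination hs⟩
  set L := z₁ ^ 2 + z₁ * z₂ + z₂ ^ 2 with hL
  set N := -(z₁ * z₂ * (z₁ + z₂)) with hN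
  set ν := w₁ - l * z₁ with hν
  obtain ⟨n, hn'⟩ : π ∣ ν - N := ⟨v₁ - m * z₁, by
    rw [hν, hN]; rw [hL] at hm; linear_combination hw₁ - z₁ * hm⟩
  obtain ⟨σ, hσ⟩ : π ∣ z₁ + z₂ + z₃ := by
    rw [← hA.dvd_mul_left, ht]
    exact ⟨b₁ * l + b₃ * l ^ 2 - b₂ * ν - 2 * b₄ * l * ν - 3 * b₆ * l ^ 2 * ν, by ring⟩
  have hσ2 : π ^ 2 ∣ (z₁ + z₂ + z₃) - π * (b₁ * L + b₃ * L ^ 2 - b₂ * N - 2 * b₄ * L * N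
      - 3 * b₆ * L ^ 2 * N) :=
    ⟨b₁ * m + b₃ * (m * (l + L)) - b₂ * n - 2 * b₄ * (m * ν + L * n)
      - 3 * b₆ * (m * (l + L) * ν + L ^ 2 * n)
      - (b₂ * l + b₄ * l ^ 2 + b₆ * l ^ 3) * σ, by
      linear_combination ht - π * (b₂ * l + b₄ * l ^ 2 + b₆ * l ^ 3) * hσ
        + π * (b₁ + b₃ * (l + L) - 2 * b₄ * ν - 3 * b₆ * (l + L) * ν) * hm
        - π * (b₂ + 2 * b₄ * L + 3 * b₆ * L ^ 2) * hn'⟩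
  obtain ⟨k, hk⟩ := hσ2
  have hl3 := h.line
  obtain ⟨v₃, hv₃⟩ : π ∣ w₃ + (z₁ + z₂) ^ 3 :=
    ⟨l * σ - m * (z₁ + z₂) + n, by
      linear_combination hl3 + l * hσ - (z₁ + z₂) * hm + hn' + (z₁ + z₂) * hL + hN⟩
  obtain ⟨t, ht'⟩ : π ∣ z - (z₁ + z₂) :=
    ⟨-σ - (b₁ * z₃ + b₃ * w₃) * z, by linear_combination hn - hσ⟩
  refine ⟨-k - b₁ * (σ * z - (z₁ + z₂) * t) - b₃ * (v₃ * z - (z₁ + z₂) ^ 3 * t), ?_⟩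
  linear_combination hn - hk - π * b₁ * (z * hσ - (z₁ + z₂) * ht')
    - π * b₃ * (z * hv₃ - (z₁ + z₂) ^ 3 * ht')
    - π * (b₁ + b₃ * (L + (z₁ + z₂) ^ 2 - z₁ * z₂)) * hL + π * (b₂ + 2 * b₄ * L + 3 * b₆ * L ^ 2) * hN

/-- The logarithm of the formal group, to first order in the coefficients `aᵢ`. -/
def approxLog (c₁ c₂ c₃ c₄ c₆ z : S) : S :=
  z - c₁ * z ^ 2 + c₂ * z ^ 3 - c₃ * z ^ 4 + c₄ * z ^ 5 + c₆ * z ^ 7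

/-- With s = z₁ + z₂, the correction F in the group law is a combination of the polynomials sⁿ - z₁ⁿ
- z₂ⁿ for n = 2, 3, 4, 5, 7. For n = 5 and 7 these are 5 z₁z₂s(z₁² + z₁z₂ + z₂²) and 7 z₁z₂s(z₁² +
z₁z₂ + z₂²)², whence the denominators in the cᵢ. The cᵢ themselves need not be divisible by π. -/
lemma approxLog_add {c₁ c₂ c₃ c₄ c₆ π z₁ w₁ z₂ w₂ l z₃ w₃ z w : S} (hW : CoeffsDvd π W)
    (h₁ : 2 * c₁ = W.a₁) (h₂ : 3 * c₂ = W.a₂) (h₃ : 2 * c₃ = W.a₃) (h₄ : 5 * c₄ = 2 * W.a₄)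
    (h₆ : 7 * c₆ = 3 * W.a₆)
    (h : IsChordSum W z₁ w₁ z₂ w₂ l z₃ w₃ z w)
    (hA : IsUnit (1 + W.a₂ * l + W.a₄ * l ^ 2 + W.a₆ * l ^ 3))
    (hw₁ : π ∣ w₁ - z₁ ^ 3) (hw₂ : π ∣ w₂ - z₂ ^ 3) :
    π ^ 2 ∣ approxLog c₁ c₂ c₃ c₄ c₆ z -
      (approxLog c₁ c₂ c₃ c₄ c₆ z₁ + approxLog c₁ c₂ c₃ c₄ c₆ z₂) := by
  have key := h.sq_dvd_sub hW hA hw₁ hw₂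
  set s := z₁ + z₂ with hs
  set F := W.a₁ * (z₁ * z₂) - W.a₂ * (z₁ * z₂ * s)
      + W.a₃ * (z₁ * z₂ * (2 * z₁ ^ 2 + 3 * z₁ * z₂ + 2 * z₂ ^ 2))
      - 2 * W.a₄ * (z₁ * z₂ * s * (z₁ ^ 2 + z₁ * z₂ + z₂ ^ 2))
      - 3 * W.a₆ * (z₁ * z₂ * s * (z₁ ^ 2 + z₁ * z₂ + z₂ ^ 2) ^ 2) with hF
  have hFπ : π ∣ F := by
    refine dvd_sub (dvd_sub (dvd_add (dvd_sub ?_ ?_) ?_) ?_) ?_ <;> apply Dvd.dvd.mul_right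
    exacts [hW.a₁, hW.a₂, hW.a₃, hW.a₄.mul_left _, hW.a₆.mul_left _]
  obtain ⟨k, hk⟩ := key
  obtain ⟨f, hf⟩ := hFπ
  -- This is L'(s) - 1. Differentiation cancels the denominators of the cᵢ, so it is divisible by π,
  -- and L(s + πg) ≡ L(s) + πg modulo π².
  obtain ⟨d, hd⟩ : π ∣ -(W.a₁ * s) + W.a₂ * s ^ 2 - 2 * W.a₃ * s ^ 3 + 2 * W.a₄ * s ^ 4
      + 3 * W.a₆ * s ^ 6 := by
    refine dvd_add (dvd_add (dvd_sub (dvd_add (dvd_neg.2 ?_) ?_) ?_) ?_) ?_ <;>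
      apply Dvd.dvd.mul_right
    exacts [hW.a₁, hW.a₂, hW.a₃.mul_left _, hW.a₄.mul_left _, hW.a₆.mul_left _]
  set g := f + π * k with hg
  have hz : z = s + π * g := by rw [hg]; linear_combination hk + hf
  obtain ⟨k₂, e₂⟩ := Polynomial.powAddExpansion s (π * g) 2
  obtain ⟨k₃, e₃⟩ := Polynomial.powAddExpansion s (π * g) 3
  obtain ⟨k₄, e₄⟩ := Polynomial.powAddExpansion s (π * g) 4
  obtain ⟨k₅, e₅⟩ := Polynomial.powAddExpansion s (π * g) 5
  obtain ⟨k₇, e₇⟩ := Polynomial.powAddExpansion s (π * g) 7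
  rw [hz]
  unfold approxLog
  rw [e₂, e₃, e₄, e₅, e₇]
  norm_num only [Nat.cast_ofNat]
  have hs0 : -c₁ * s ^ 2 + c₂ * s ^ 3 - c₃ * s ^ 4 + c₄ * s ^ 5 + c₆ * s ^ 7 + F
      = -c₁ * z₁ ^ 2 + c₂ * z₁ ^ 3 - c₃ * z₁ ^ 4 + c₄ * z₁ ^ 5 + c₆ * z₁ ^ 7
      + (-c₁ * z₂ ^ 2 + c₂ * z₂ ^ 3 - c₃ * z₂ ^ 4 + c₄ * z₂ ^ 5 + c₆ * z₂ ^ 7) := by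
    rw [hF, hs, mul_assoc 2 W.a₄, mul_assoc 3 W.a₆, ← mul_assoc 2 W.a₄, ← mul_assoc 3 W.a₆,
      ← h₁, ← h₂, ← h₃, ← h₄, ← h₆]
    ring
  refine ⟨k + g * d - c₁ * k₂ * g ^ 2 + c₂ * k₃ * g ^ 2 - c₃ * k₄ * g ^ 2 + c₄ * k₅ * g ^ 2
    + c₆ * k₇ * g ^ 2, ?_⟩
  linear_combination hs0 - hf + π * g * hd + π * hg + π * g * (-s * h₁ + s ^ 2 * h₂
    - 2 * s ^ 3 * h₃ + s ^ 4 * h₄ + s ^ 6 * h₆) + hs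

end Algebra

/-! ### The coordinate `z` on `E₀(K)` -/

section Filtration

variable {R : Type*} [CommRing R] [IsDomain R] [ValuationRing R] {K : Type*} [Field K]
  [Algebra R K] [IsFractionRing R K] [DecidableEq K] {W : WeierstrassCurve R}
  {hW : CoeffsInMaximalIdeal W}

lemma exists_hasCoords (P : goodReductionSubgroup (K := K) W hW) :
    ∃ zw : R × R, HasCoords P.1 zw.1 zw.2 := by
  obtain ⟨z, w, h⟩ := (hasNonsingularReduction_iff_exists_hasCoords hW
    (IsFractionRing.injective R K)).1 P.2
  exact ⟨(z, w), h⟩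

/-- The coordinate `z = x / y` of a point of `E₀(K)`. -/
noncomputable def zCoord (P : goodReductionSubgroup (K := K) W hW) : R :=
  (exists_hasCoords P).choose.1

/-- The coordinate `w = 1 / y` of a point of `E₀(K)`. -/
noncomputable def wCoord (P : goodReductionSubgroup (K := K) W hW) : R :=
  (exists_hasCoords P).choose.2

lemma hasCoords_zCoord (P : goodReductionSubgroup (K := K) W hW) :
    HasCoords P.1 (zCoord P) (wCoord P) := (exists_hasCoords P).choose_spec

lemma curveEq_zCoord (P : goodReductionSubgroup (K := K) W hW) :
    CurveEq W (zCoord P) (wCoord P) :=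
  (hasCoords_zCoord P).curveEq (IsFractionRing.injective R K)

@[simp] lemma zCoord_zero : zCoord (0 : goodReductionSubgroup (K := K) W hW) = 0 :=
  (hasCoords_zCoord (0 : goodReductionSubgroup (K := K) W hW)).eq_zero.1

lemma isChordSum_zCoord (P Q : goodReductionSubgroup (K := K) W hW) :
    ∃ l z₃ w₃, IsChordSum W (zCoord P) (wCoord P) (zCoord Q) (wCoord Q) l z₃ w₃
      (zCoord (P + Q)) (wCoord (P + Q)) := by
  obtain ⟨l, z₃, w₃, z, w, h, h'⟩ := HasCoords.add hW (hasCoords_zCoord P) (hasCoords_zCoord Q)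
  obtain ⟨rfl, rfl⟩ := h.unique (IsFractionRing.injective R K) (hasCoords_zCoord (P + Q))
  exact ⟨l, z₃, w₃, h'⟩

/-- z determines w modulo every ideal, so congruences need only be checked on z. -/
lemma map_wCoord_eq {S : Type*} [CommRing S] (f : R →+* S)
    {P Q : goodReductionSubgroup (K := K) W hW} (h : f (zCoord P) = f (zCoord Q)) :
    f (wCoord P) = f (wCoord Q) := by
  have h₁ := (curveEq_zCoord P).map f
  have h₂ := (curveEq_zCoord Q).map f
  rw [← h] at h₂
  refine h₁.w_unique h₂ ?_
  simpa using (isUnit_slope_denom hW (zCoord P) (wCoord P) (wCoord Q)).map f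

lemma zCoord_injective :
    Function.Injective (zCoord : goodReductionSubgroup (K := K) W hW → R) := by
  intro P Q h
  have hw : wCoord P = wCoord Q := map_wCoord_eq (RingHom.id R) h
  apply Subtype.ext
  refine (hasCoords_zCoord P).ext ?_
  rw [h, hw]
  exact hasCoords_zCoord Q

lemma exists_zCoord_eq [(W.baseChange K).IsElliptic] {z w : R} (h : CurveEq W z w) :
    ∃ P : goodReductionSubgroup (K := K) W hW, zCoord P = z := by
  by_cases hw : w = 0
  · refine ⟨0, ?_⟩
    -- w = 0 on the curve leaves only the origin, which is the point at infinity of E.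
    have : z ^ 3 = 0 := by
      unfold CurveEq at h
      rw [hw] at h
      linear_combination -h
    rw [zCoord_zero, pow_eq_zero_iff (three_ne_zero) |>.1 this]
  · obtain ⟨P, hP⟩ := exists_hasCoords_of_curveEq (K := K) (IsFractionRing.injective R K) h hw
    let P' : goodReductionSubgroup (K := K) W hW :=
      ⟨P, (hasNonsingularReduction_iff_exists_hasCoords hW
        (IsFractionRing.injective R K)).2 ⟨z, w, hP⟩⟩
    exact ⟨P', ((hasCoords_zCoord P').unique (IsFractionRing.injective R K) hP).1⟩

/-- The chord formulas survive in S with unit denominators, so f(z) of a sum depends only on f(z) of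
the summands. With f the quotient by an ideal I, this makes {z ∈ I} a subgroup whose cosets are the
fibres of z modulo I. -/
lemma map_zCoord_add_congr {S : Type*} [CommRing S] (f : R →+* S)
    {P P' Q Q' : goodReductionSubgroup (K := K) W hW} (hP : f (zCoord P) = f (zCoord P'))
    (hQ : f (zCoord Q) = f (zCoord Q')) : f (zCoord (P + Q)) = f (zCoord (P' + Q')) := by
  obtain ⟨l, z₃, w₃, h⟩ := isChordSum_zCoord P Q
  obtain ⟨l', z₃', w₃', h'⟩ := isChordSum_zCoord P' Q'
  have h₁ := h.map f
  have h₂ := h'.map f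
  rw [← hP, ← hQ, ← map_wCoord_eq f hP, ← map_wCoord_eq f hQ] at h₂
  refine h₁.unique h₂ ?_ ?_ ?_
  · simpa using (isUnit_slope_denom hW (zCoord P) (wCoord P) (wCoord Q)).map f
  · simpa using (isUnit_third_denom hW l).map f
  · simpa using (isUnit_neg_denom hW z₃ w₃).map f

/-- The subgroup of points whose coordinate `z` lies in a given ideal. -/
def level (hW : CoeffsInMaximalIdeal W) (I : Ideal R) :
    AddSubgroup (goodReductionSubgroup (K := K) W hW) where
  carrier := {P | zCoord P ∈ I}
  zero_mem' := by simp
  add_mem' {P Q} hP hQ := by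
    have h := map_zCoord_add_congr (Ideal.Quotient.mk I) (P := P) (P' := 0) (Q := Q) (Q' := 0)
      (by simpa [Ideal.Quotient.eq_zero_iff_mem] using hP)
      (by simpa [Ideal.Quotient.eq_zero_iff_mem] using hQ)
    simpa [Ideal.Quotient.eq_zero_iff_mem] using h
  neg_mem' {P} hP := by
    -- Replacing P by 0 in P + (-P) = 0 shows that z(-P) vanishes modulo I.
    have h := map_zCoord_add_congr (Ideal.Quotient.mk I) (P := P) (P' := 0) (Q := -P) (Q' := -P)
      (by simpa [Ideal.Quotient.eq_zero_iff_mem] using hP) rfl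
    simp only [add_neg_cancel, zCoord_zero, map_zero, zero_add] at h
    exact Ideal.Quotient.eq_zero_iff_mem.1 h.symm

lemma mem_level {I : Ideal R} {P : goodReductionSubgroup (K := K) W hW} :
    P ∈ level hW I ↔ zCoord P ∈ I := Iff.rfl

lemma sub_mem_level {I : Ideal R} {P Q : goodReductionSubgroup (K := K) W hW} :
    P - Q ∈ level hW I ↔ zCoord P - zCoord Q ∈ I := by
  rw [mem_level, ← Ideal.Quotient.eq_zero_iff_mem, ← Ideal.Quotient.eq]
  constructor
  · intro h
    have := map_zCoord_add_congr (Ideal.Quotient.mk I) (P := P - Q) (P' := 0) (Q := Q) (Q' := Q)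
      (by simpa using h) rfl
    simpa using this
  · intro h
    have := map_zCoord_add_congr (Ideal.Quotient.mk I) (P := P) (P' := Q) (Q := -Q) (Q' := -Q)
      h rfl
    simpa [← sub_eq_add_neg] using this

lemma pow_three_dvd_wCoord (P : goodReductionSubgroup (K := K) W hW) :
    zCoord P ^ 3 ∣ wCoord P :=
  (curveEq_zCoord P).pow_three_dvd (isUnit_slope_denom hW _ _ _)

variable {π : R}

lemma CoeffsInMaximalIdeal.coeffsDvd (hW : CoeffsInMaximalIdeal W)
    (hπ : IsLocalRing.maximalIdeal R = Ideal.span {π}) : CoeffsDvd π W := by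
  obtain ⟨h₁, h₂, h₃, h₄, h₆⟩ := hW
  rw [hπ, Ideal.mem_span_singleton] at h₁ h₂ h₃ h₄ h₆
  exact ⟨h₁, h₂, h₃, h₄, h₆⟩

lemma dvd_zCoord_add_sub (hπ : CoeffsDvd π W) {q : R}
    {P Q : goodReductionSubgroup (K := K) W hW} (hP : q ∣ zCoord P) (hQ : q ∣ zCoord Q) :
    π * q ^ 2 ∣ zCoord (P + Q) - (zCoord P + zCoord Q) := by
  obtain ⟨l, z₃, w₃, h⟩ := isChordSum_zCoord P Q
  exact h.dvd_sub_add hπ (isUnit_slope_denom hW _ _ _) (isUnit_third_denom hW _)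
    (isUnit_neg_denom hW _ _) hP hQ (pow_three_dvd_wCoord P) (pow_three_dvd_wCoord Q)

lemma dvd_zCoord_nsmul_sub (hπ : CoeffsDvd π W) {q : R}
    {P : goodReductionSubgroup (K := K) W hW} (hP : q ∣ zCoord P) (n : ℕ) :
    π * q ^ 2 ∣ zCoord (n • P) - n * zCoord P := by
  induction n with
  | zero => simp
  | succ n ih =>
    have hn : q ∣ zCoord (n • P) := by
      have : q ∣ π * q ^ 2 := (dvd_pow_self q two_ne_zero).mul_left _
      exact (dvd_sub_left (hP.mul_left _)).1 (this.trans ih)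
    have h := dvd_add (dvd_zCoord_add_sub hπ hn hP) ih
    rw [succ_nsmul]
    convert h using 1
    push_cast
    ring

lemma sq_dvd_approxLog_nsmul_sub (hπ : CoeffsDvd π W) {c₁ c₂ c₃ c₄ c₆ : R} (h₁ : 2 * c₁ = W.a₁)
    (h₂ : 3 * c₂ = W.a₂) (h₃ : 2 * c₃ = W.a₃) (h₄ : 5 * c₄ = 2 * W.a₄) (h₆ : 7 * c₆ = 3 * W.a₆)
    (P : goodReductionSubgroup (K := K) W hW) (n : ℕ) :
    π ^ 2 ∣ approxLog c₁ c₂ c₃ c₄ c₆ (zCoord (n • P)) -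
      n * approxLog c₁ c₂ c₃ c₄ c₆ (zCoord P) := by
  induction n with
  | zero => simp [approxLog]
  | succ n ih =>
    obtain ⟨l, z₃, w₃, h⟩ := isChordSum_zCoord (n • P) P
    have h' := approxLog_add hπ h₁ h₂ h₃ h₄ h₆ h (isUnit_third_denom hW _)
      ((curveEq_zCoord _).dvd_sub_pow_three hπ) ((curveEq_zCoord _).dvd_sub_pow_three hπ)
    have h := dvd_add h' ih
    rw [succ_nsmul]
    convert h using 1
    push_cast
    ring

/-- Multiplication by `p` modulo `p ^ 2`. -/
lemma sq_dvd_zCoord_prime_nsmul_sub {p : ℕ} (hπ : CoeffsDvd (p : R) W) {c₁ c₂ c₃ c₄ c₆ : R}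
    (h₁ : 2 * c₁ = W.a₁)
    (h₂ : 3 * c₂ = W.a₂) (h₃ : 2 * c₃ = W.a₃) (h₄ : 5 * c₄ = 2 * W.a₄) (h₆ : 7 * c₆ = 3 * W.a₆)
    (P : goodReductionSubgroup (K := K) W hW) :
    (p : R) ^ 2 ∣ zCoord (p • P) - p * approxLog c₁ c₂ c₃ c₄ c₆ (zCoord P) := by
  have h := sq_dvd_approxLog_nsmul_sub hπ h₁ h₂ h₃ h₄ h₆ P p
  have h' := dvd_zCoord_nsmul_sub hπ (one_dvd (zCoord P)) p
  -- Additivity modulo p is the case q = 1. With z(pP) = pt, the nonlinear terms of L(pt) are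
  -- divisible by p², so L may be dropped on the left.
  obtain ⟨t, ht⟩ : (p : R) ∣ zCoord (p • P) := by
    rw [one_pow, mul_one] at h'
    exact (dvd_sub_left (dvd_mul_right _ _)).1 h'
  obtain ⟨k, hk⟩ := h
  refine ⟨k + c₁ * t ^ 2 - c₂ * p * t ^ 3 + c₃ * p ^ 2 * t ^ 4 - c₄ * p ^ 3 * t ^ 5
    - c₆ * p ^ 5 * t ^ 7, ?_⟩
  unfold approxLog at hk ⊢
  rw [ht] at hk ⊢
  linear_combination hk

end Filtration

/-! ### Complete filtered groups as `ℤ_p`-modules -/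

section FilteredGroup

variable {p : ℕ} [hp : Fact p.Prime] {G : Type*} [AddCommGroup G]

/-- A complete separated filtration by subgroups, with `p • E m ⊆ E (m + 1)`. -/
structure IsCompleteFiltration (p : ℕ) (E : ℕ → AddSubgroup G) : Prop where
  zero : E 0 = ⊤
  anti : Antitone E
  eq_zero : ∀ x, (∀ m, x ∈ E m) → x = 0
  complete : ∀ x : ℕ → G, (∀ m, x (m + 1) - x m ∈ E m) → ∃ y, ∀ m, y - x m ∈ E m
  nsmul_mem : ∀ m x, x ∈ E m → p • x ∈ E (m + 1)

variable {E : ℕ → AddSubgroup G}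

omit hp in
lemma IsCompleteFiltration.zsmul_mem (hE : IsCompleteFiltration p E) (m : ℕ) {a : ℤ}
    (ha : (p : ℤ) ^ m ∣ a) (x : G) : a • x ∈ E m := by
  have h : ∀ m : ℕ, (p ^ m) • x ∈ E m := by
    intro m
    induction m with
    | zero => rw [hE.zero]; trivial
    | succ m ih => rw [pow_succ', mul_smul]; exact hE.nsmul_mem m _ ih
  obtain ⟨b, rfl⟩ := ha
  rw [mul_comm, mul_smul]
  refine (E m).zsmul_mem ?_ b
  have := h m
  rwa [← natCast_zsmul, Nat.cast_pow] at this

/-- `y` is the product of `x` with the `p`-adic integer `c`. -/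
def IsPadicSMul (E : ℕ → AddSubgroup G) (c : ℤ_[p]) (x y : G) : Prop :=
  ∀ (m : ℕ) (N : ℤ), (p : ℤ_[p]) ^ m ∣ c - N → y - N • x ∈ E m

lemma pow_dvd_sub_appr (c : ℤ_[p]) (m : ℕ) : (p : ℤ_[p]) ^ m ∣ c - ((c.appr m : ℤ) : ℤ_[p]) := by
  have := PadicInt.appr_spec m c
  rw [Ideal.mem_span_singleton] at this
  simpa using this

/-- One integer approximation of c per level suffices: two of them differ by a multiple of p^m,
which sends x into E m. -/
lemma IsCompleteFiltration.isPadicSMul_of (hE : IsCompleteFiltration p E) {c : ℤ_[p]} {x y : G}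
    (h : ∀ m, ∃ N : ℤ, (p : ℤ_[p]) ^ m ∣ c - N ∧ y - N • x ∈ E m) : IsPadicSMul E c x y := by
  intro m N hN
  obtain ⟨N', hN', hy⟩ := h m
  have hd : (p : ℤ) ^ m ∣ N' - N := by
    rw [← PadicInt.pow_p_dvd_int_iff]
    convert dvd_sub hN hN' using 1
    push_cast; ring
  have := (E m).add_mem hy (hE.zsmul_mem m hd x)
  convert this using 1
  rw [sub_smul]; abel

lemma IsCompleteFiltration.exists_isPadicSMul (hE : IsCompleteFiltration p E) (c : ℤ_[p]) (x : G) :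
    ∃ y, IsPadicSMul E c x y := by
  obtain ⟨y, hy⟩ := hE.complete (fun m => (c.appr m : ℤ) • x) (by
    intro m
    rw [← sub_smul]
    apply hE.zsmul_mem
    rw [← PadicInt.pow_p_dvd_int_iff]
    have h1 := pow_dvd_sub_appr c m
    have h2 := (pow_dvd_pow (p : ℤ_[p]) m.le_succ).trans (pow_dvd_sub_appr c (m + 1))
    convert dvd_sub h1 h2 using 1
    push_cast; ring)
  exact ⟨y, hE.isPadicSMul_of fun m => ⟨_, pow_dvd_sub_appr c m, hy m⟩⟩

lemma IsPadicSMul.unique (hE : IsCompleteFiltration p E) {c : ℤ_[p]} {x y y' : G}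
    (h : IsPadicSMul E c x y) (h' : IsPadicSMul E c x y') : y = y' := by
  rw [← sub_eq_zero]
  refine hE.eq_zero _ fun m => ?_
  have := (E m).sub_mem (h m _ (pow_dvd_sub_appr c m)) (h' m _ (pow_dvd_sub_appr c m))
  rwa [sub_sub_sub_cancel_right] at this

/-- A complete filtered group is a `ℤ_p`-module. -/
theorem IsCompleteFiltration.exists_module (hE : IsCompleteFiltration p E) :
    ∃ M : Module ℤ_[p] G, ∀ (c : ℤ_[p]) (x : G), IsPadicSMul E c x (M.smul c x) := by
  choose s hs using hE.exists_isPadicSMul (p := p)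
  have int : ∀ (N : ℤ) (x : G), IsPadicSMul E (N : ℤ_[p]) x (N • x) := fun N x =>
    hE.isPadicSMul_of fun m => ⟨N, by simp, by simp⟩
  -- Each axiom holds by uniqueness: its other side is also a p-adic product, as integer
  -- approximations of the scalars show.
  refine ⟨{ smul := s
            one_smul := fun x => ?_
            mul_smul := fun c d x => ?_
            smul_zero := fun c => ?_
            smul_add := fun c x y => ?_
            add_smul := fun c d x => ?_
            zero_smul := fun x => ?_ }, hs⟩
  · refine (hs (c * d) x).unique hE (hE.isPadicSMul_of fun m =>
      ⟨(c.appr m : ℤ) * (d.appr m : ℤ), ?_, ?_⟩)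
    · have h1 := (pow_dvd_sub_appr c m).mul_right d
      have h2 := (pow_dvd_sub_appr d m).mul_left ((c.appr m : ℤ) : ℤ_[p])
      convert dvd_add h1 h2 using 1
      push_cast; ring
    · have h1 := hs c (s d x) m _ (pow_dvd_sub_appr c m)
      have h2 := (E m).zsmul_mem (hs d x m _ (pow_dvd_sub_appr d m)) (c.appr m)
      convert (E m).add_mem h1 h2 using 1
      rw [smul_sub, mul_smul]
      change s c (s d x) - _ = _
      abel
  · exact (hs 1 x).unique hE (by simpa using int 1 x)
  · exact (hs c 0).unique hE (hE.isPadicSMul_of fun m => ⟨_, pow_dvd_sub_appr c m, by simp⟩)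
  · refine (hs c (x + y)).unique hE (hE.isPadicSMul_of fun m => ⟨_, pow_dvd_sub_appr c m, ?_⟩)
    convert (E m).add_mem (hs c x m _ (pow_dvd_sub_appr c m)) (hs c y m _ (pow_dvd_sub_appr c m))
      using 1
    rw [smul_add]
    change s c x + s c y - _ = _
    abel
  · refine (hs (c + d) x).unique hE (hE.isPadicSMul_of fun m =>
      ⟨(c.appr m : ℤ) + (d.appr m : ℤ), ?_, ?_⟩)
    · convert dvd_add (pow_dvd_sub_appr c m) (pow_dvd_sub_appr d m) using 1
      push_cast; ring
    · convert (E m).add_mem (hs c x m _ (pow_dvd_sub_appr c m))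
        (hs d x m _ (pow_dvd_sub_appr d m)) using 1
      rw [add_smul]
      change s c x + s d x - _ = _
      abel
  · exact (hs 0 x).unique hE (by simpa using int 0 x)

lemma IsPadicSMul.mem {c : ℤ_[p]} {x y : G} (h : IsPadicSMul E c x y) {m : ℕ} (hx : x ∈ E m) :
    y ∈ E m := by
  have := (E m).add_mem (h m _ (pow_dvd_sub_appr c m)) ((E m).zsmul_mem hx (c.appr m))
  rwa [sub_add_cancel] at this

lemma IsPadicSMul.sub_mem {c d : ℤ_[p]} {x y y' : G} (h : IsPadicSMul E c x y)
    (h' : IsPadicSMul E d x y') {m : ℕ} (hcd : (p : ℤ_[p]) ^ m ∣ c - d) : y - y' ∈ E m := by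
  have h1 := h m (d.appr m) (by
    convert dvd_add hcd (pow_dvd_sub_appr d m) using 1
    ring)
  have := (E m).sub_mem h1 (h' m _ (pow_dvd_sub_appr d m))
  rwa [sub_sub_sub_cancel_right] at this

end FilteredGroup

/-! ### The structure of certain `ℤ_p`-modules -/

section PadicModule

variable {p : ℕ} [hp : Fact p.Prime]

lemma mem_span_pow_smul_top {R M : Type*} [CommRing R] [AddCommGroup M] [Module R M] (r : R)
    (m : ℕ) (x : M) : x ∈ (Ideal.span {r} ^ m • ⊤ : Submodule R M) ↔ ∃ y, r ^ m • y = x := by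
  rw [Ideal.span_singleton_pow, Submodule.ideal_span_singleton_smul,
    Submodule.mem_smul_pointwise_iff_exists]
  simp

/-- Limits are taken coordinatewise. It serves the complete form of Nakayama's lemma, applied to a
map from ι → ℤ_p. -/
instance isPrecomplete_pi (ι : Type*) :
    IsPrecomplete (Ideal.span {(p : ℤ_[p])}) (ι → ℤ_[p]) where
  prec' f hf := by
    have hc : ∀ i, ∃ L : ℤ_[p], ∀ n, ∃ y, (p : ℤ_[p]) ^ n • y = f n i - L := by
      intro i
      have h := (inferInstance : IsPrecomplete (IsLocalRing.maximalIdeal ℤ_[p]) ℤ_[p]).prec'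
        (fun n => f n i) (by
          intro m n hmn
          have := hf hmn
          rw [SModEq.sub_mem, mem_span_pow_smul_top] at this
          obtain ⟨y, hy⟩ := this
          rw [PadicInt.maximalIdeal_eq_span_p, SModEq.sub_mem, mem_span_pow_smul_top]
          exact ⟨y i, congrFun hy i⟩)
      obtain ⟨L, hL⟩ := h
      refine ⟨L, fun n => ?_⟩
      have := hL n
      rwa [PadicInt.maximalIdeal_eq_span_p, SModEq.sub_mem, mem_span_pow_smul_top] at this
    choose L y hy using hc
    refine ⟨L, fun n => ?_⟩
    rw [SModEq.sub_mem, mem_span_pow_smul_top]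
    exact ⟨fun i => y i n, funext fun i => hy i n⟩

/-- A separated `ℤ_p`-module which is finite modulo `p` is finitely generated. -/
lemma finite_of_finite_quotient {M : Type*} [AddCommGroup M] [Module ℤ_[p] M]
    (hsep : ∀ x : M, (∀ m : ℕ, ∃ y, (p : ℤ_[p]) ^ m • y = x) → x = 0)
    {A : Type*} [Finite A] (g : M → A) (hg : ∀ x y, g x = g y → ∃ t, (p : ℤ_[p]) • t = x - y) :
    Module.Finite ℤ_[p] M := by
  have : IsHausdorff (Ideal.span {(p : ℤ_[p])}) M := ⟨fun x hx => hsep x fun m => by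
    have := hx m
    rwa [SModEq.zero, mem_span_pow_smul_top] at this⟩
  have : Fintype (Set.range g) := Fintype.ofFinite _
  -- One generator per value of g: elements with the same value differ by a multiple of p, so f is
  -- onto modulo p.
  let f : (Set.range g → ℤ_[p]) →ₗ[ℤ_[p]] M :=
    Fintype.linearCombination ℤ_[p] fun a => (a.2.choose)
  refine Module.Finite.of_surjective f
    (surjective_of_mkQ_comp_surjective (I := Ideal.span {(p : ℤ_[p])}) ?_)
  intro y
  obtain ⟨x, rfl⟩ := Submodule.mkQ_surjective _ y
  classical
  let a : Set.range g := ⟨g x, x, rfl⟩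
  refine ⟨Pi.single a 1, ?_⟩
  have ha : f (Pi.single a 1) = a.2.choose := by
    simp [f, Fintype.linearCombination_apply_single]
  rw [LinearMap.comp_apply, ha, Submodule.mkQ_apply, Submodule.mkQ_apply,
    Submodule.Quotient.eq]
  obtain ⟨t, ht⟩ := hg _ _ a.2.choose_spec
  have := (mem_span_pow_smul_top (p : ℤ_[p]) 1 (a.2.choose - x)).2 ⟨t, by rwa [pow_one]⟩
  rwa [pow_one] at this

/-- The number of elements of `M / p M`, for a free module `M`. -/
lemma card_eq_pow_of_ker_eq {M : Type*} [AddCommGroup M] [Module ℤ_[p] M] {r : ℕ}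
    (e : M ≃ₗ[ℤ_[p]] (Fin r → ℤ_[p])) {A : Type*} [AddCommGroup A] (g : M →+ A)
    (hg : Function.Surjective g) (hker : ∀ x, g x = 0 ↔ ∃ t, (p : ℤ_[p]) • t = x) :
    Nat.card A = p ^ r := by
  -- Reduction of coordinates has the same kernel pM as g, so M/pM is counted twice.
  let h : M →+ (Fin r → ZMod p) :=
    (AddMonoidHom.pi fun i => (PadicInt.toZMod (p := p)).toAddMonoidHom.comp
      (Pi.evalAddMonoidHom (fun _ : Fin r => ℤ_[p]) i)).comp e.toLinearMap.toAddMonoidHom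
  have hh : ∀ x i, h x i = PadicInt.toZMod (e x i) := fun x i => rfl
  have hsurj : Function.Surjective h := by
    intro v
    refine ⟨e.symm fun i => ((v i).val : ℤ_[p]), ?_⟩
    ext i
    rw [hh]
    simp
  have hk : h.ker = g.ker := by
    ext x
    rw [AddMonoidHom.mem_ker, AddMonoidHom.mem_ker, hker]
    constructor
    · intro hx
      have : ∀ i, ∃ t, (p : ℤ_[p]) * t = e x i := by
        intro i
        have h1 : PadicInt.toZMod (e x i) = 0 := by rw [← hh, hx]; rfl
        have h2 : e x i ∈ RingHom.ker (PadicInt.toZMod (p := p)) := h1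
        rw [PadicInt.ker_toZMod, PadicInt.maximalIdeal_eq_span_p, Ideal.mem_span_singleton] at h2
        obtain ⟨t, ht⟩ := h2
        exact ⟨t, ht.symm⟩
      choose t ht using this
      refine ⟨e.symm t, e.injective ?_⟩
      rw [map_smul, LinearEquiv.apply_symm_apply]
      exact funext ht
    · rintro ⟨t, rfl⟩
      ext i
      rw [hh, map_smul]
      simp
  have e1 := (QuotientAddGroup.quotientKerEquivOfSurjective g hg).toEquiv
  have e2 := (QuotientAddGroup.quotientKerEquivOfSurjective h hsurj).toEquiv
  rw [hk] at e2
  rw [← Nat.card_congr e1, Nat.card_congr e2, Nat.card_fun]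
  simp

end PadicModule

/-! ### From the layers of a filtered ℤ_p-module to its structure -/

section Structure

variable {p : ℕ} [hp : Fact p.Prime]

/-- A finitely generated `ℤ_p`-module killed by `p` is a sum of copies of `ℤ_p / p`. -/
lemma exists_linearEquiv_of_prime_smul_eq_zero {T : Type*} [AddCommGroup T] [Module ℤ_[p] T]
    [Module.Finite ℤ_[p] T] (hT : ∀ x : T, (p : ℤ_[p]) • x = 0) :
    ∃ b : ℕ, Nat.card T = p ^ b ∧
      Nonempty (T ≃ₗ[ℤ_[p]] (Fin b → ℤ_[p] ⧸ Ideal.span {(p : ℤ_[p])})) := by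
  set I := Ideal.span {(p : ℤ_[p])} with hI
  have hmax : IsLocalRing.maximalIdeal ℤ_[p] = I := PadicInt.maximalIdeal_eq_span_p
  have : I.IsMaximal := by rw [← hmax]; infer_instance
  let : Field (ℤ_[p] ⧸ I) := Ideal.Quotient.field I
  have htors : Module.IsTorsionBySet ℤ_[p] T I := by
    rintro x ⟨a, ha⟩
    obtain ⟨c, rfl⟩ := Ideal.mem_span_singleton.1 ha
    change ((p : ℤ_[p]) * c) • x = 0
    rw [mul_smul, hT]
  let : Module (ℤ_[p] ⧸ I) T := htors.module
  have : IsScalarTower ℤ_[p] (ℤ_[p] ⧸ I) T := htors.isScalarTower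
  have : Module.Finite (ℤ_[p] ⧸ I) T := Module.Finite.of_restrictScalars_finite ℤ_[p] _ _
  have e := (Module.finBasis (ℤ_[p] ⧸ I) T).equivFun
  refine ⟨_, ?_, ⟨e.restrictScalars ℤ_[p]⟩⟩
  have hcard : Nat.card (ℤ_[p] ⧸ I) = p := by
    have e' : (ℤ_[p] ⧸ I) ≃+* ZMod p :=
      (Ideal.quotEquivOfEq (hmax.symm.trans PadicInt.ker_toZMod.symm)).trans
        (RingHom.quotientKerEquivOfSurjective (ZMod.ringHom_surjective PadicInt.toZMod))
    rw [Nat.card_congr e'.toEquiv, Nat.card_zmod]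
  rw [Nat.card_congr e.toEquiv, Nat.card_fun, hcard, Nat.card_eq_fintype_card, Fintype.card_fin]

variable {G : Type*} [AddCommGroup G] [Module ℤ_[p] G]

/-- A complete separated filtration of a `ℤ_p`-module such that multiplication by `p` induces
isomorphisms `F m / F (m + 1) → F (m + 1) / F (m + 2)` for `m ≥ 1`. -/
structure IsPadicFiltration (F : ℕ → Submodule ℤ_[p] G) : Prop where
  zero : F 0 = ⊤
  anti : Antitone F
  eq_zero : ∀ x, (∀ m, x ∈ F m) → x = 0
  complete : ∀ x : ℕ → G, (∀ m, x (m + 1) - x m ∈ F m) → ∃ y, ∀ m, y - x m ∈ F m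
  smul_mem : ∀ m x, x ∈ F m → (p : ℤ_[p]) • x ∈ F (m + 1)
  mem_of_smul_mem : ∀ m x, 1 ≤ m → x ∈ F m → (p : ℤ_[p]) • x ∈ F (m + 2) → x ∈ F (m + 1)
  exists_sub_mem : ∀ m y, 1 ≤ m → y ∈ F (m + 1) → ∃ x ∈ F m, y - (p : ℤ_[p]) • x ∈ F (m + 2)

variable {F : ℕ → Submodule ℤ_[p] G}

/-- Successive approximation: surjectivity on each layer removes the remainder one level at a time,
and completeness sums the corrections. Hence p F_m = F_{m+1} for m ≥ 1. -/
lemma IsPadicFiltration.exists_smul_eq (hF : IsPadicFiltration F) {m : ℕ} (hm : 1 ≤ m) {y : G}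
    (hy : y ∈ F (m + 1)) : ∃ x ∈ F m, (p : ℤ_[p]) • x = y := by
  -- The membership is moved behind the existential, with default 0 otherwise, so that the choice is
  -- a total function usable in a recursion.
  have H : ∀ (k : ℕ) (u : G), ∃ x, u ∈ F (m + k + 1) →
      x ∈ F (m + k) ∧ u - (p : ℤ_[p]) • x ∈ F (m + k + 2) := by
    intro k u
    by_cases hu : u ∈ F (m + k + 1)
    · obtain ⟨x, hx, h⟩ := hF.exists_sub_mem (m + k) u (by omega) hu
      exact ⟨x, fun _ => ⟨hx, h⟩⟩
    · exact ⟨0, fun h => absurd h hu⟩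
  choose f hf using H
  let u : ℕ → G := fun k => Nat.rec y (fun k u => u - (p : ℤ_[p]) • f k u) k
  have hu_succ : ∀ k, u (k + 1) = u k - (p : ℤ_[p]) • f k (u k) := fun k => rfl
  have hu : ∀ k, u k ∈ F (m + k + 1) := by
    intro k
    induction k with
    | zero => exact hy
    | succ k ih => rw [hu_succ]; exact (hf k _ ih).2
  let x : ℕ → G := fun k => ∑ i ∈ Finset.range k, f i (u i)
  have hx_succ : ∀ k, x (k + 1) = x k + f k (u k) := fun k => Finset.sum_range_succ _ _
  have hxu : ∀ k, y - (p : ℤ_[p]) • x k = u k := by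
    intro k
    induction k with
    | zero => simp [x, u]
    | succ k ih => rw [hx_succ, hu_succ, ← ih, smul_add]; abel
  have hxm : ∀ k, x k ∈ F m := fun k =>
    Submodule.sum_mem _ fun i _ => hF.anti (Nat.le_add_right m i) (hf i _ (hu i)).1
  obtain ⟨z, hz⟩ := hF.complete x fun k => by
    rw [hx_succ, add_sub_cancel_left]
    exact hF.anti (Nat.le_add_left k m) (hf k _ (hu k)).1
  refine ⟨z, ?_, ?_⟩
  · have := (F m).add_mem (hz m) (hxm m)
    rwa [sub_add_cancel] at this
  · symm
    rw [← sub_eq_zero]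
    refine hF.eq_zero _ fun k => ?_
    have h1 : u k ∈ F k := hF.anti (by omega) (hu k)
    have h2 := (F k).smul_mem (p : ℤ_[p]) (hz k)
    convert (F k).sub_mem h1 h2 using 1
    rw [← hxu, smul_sub]; abel

/-- If p x = 0, injectivity on the layers pushes x from each level into the next. -/
lemma IsPadicFiltration.eq_zero_of_smul (hF : IsPadicFiltration F) {x : G} (hx : x ∈ F 1)
    (h : (p : ℤ_[p]) • x = 0) : x = 0 := by
  refine hF.eq_zero x fun m => ?_
  suffices h : ∀ m, x ∈ F (m + 1) from hF.anti m.le_succ (h m)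
  intro m
  induction m with
  | zero => exact hx
  | succ m ih => exact hF.mem_of_smul_mem (m + 1) x (by omega) ih (by rw [h]; exact zero_mem _)

/-- A nonzero p-adic integer is a unit times a power of p. -/
lemma eq_zero_of_smul_eq_zero_of_prime {M : Type*} [AddCommGroup M] [Module ℤ_[p] M]
    (h : ∀ x : M, (p : ℤ_[p]) • x = 0 → x = 0) {c : ℤ_[p]} (hc : c ≠ 0) {x : M}
    (hx : c • x = 0) : x = 0 := by
  rw [PadicInt.unitCoeff_spec hc, mul_smul] at hx
  have h' : (p : ℤ_[p]) ^ c.valuation • x = 0 := by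
    have := congrArg (fun t => (↑(PadicInt.unitCoeff hc)⁻¹ : ℤ_[p]) • t) hx
    simpa [smul_smul] using this
  generalize c.valuation = k at h'
  induction k with
  | zero => simpa using h'
  | succ k ih =>
    rw [pow_succ', mul_smul] at h'
    exact ih (h _ h')

lemma IsPadicFiltration.isTorsionFree (hF : IsPadicFiltration F) :
    Module.IsTorsionFree ℤ_[p] (F 1) where
  isSMulRegular c hc := by
    intro x y hxy
    rw [← sub_eq_zero]
    refine eq_zero_of_smul_eq_zero_of_prime (p := p) (fun x hx => ?_) hc.ne_zero
      (c := c) (by rw [smul_sub, sub_eq_zero]; exact hxy)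
    exact Subtype.ext (hF.eq_zero_of_smul x.2 (congrArg Subtype.val hx))

/-- The structure of a `ℤ_p`-module with a filtration whose layers are known. -/
theorem IsPadicFiltration.exists_linearEquiv (hF : IsPadicFiltration F) {A : Type*}
    [AddCommGroup A] {n : ℕ} (hA : Nat.card A = p ^ n)
    (g₀ : G → A) (hg₀ : ∀ x y, g₀ x = g₀ y → x - y ∈ F 1)
    (g₁ : F 1 →+ A) (hg₁ : Function.Surjective g₁) (hker : ∀ x, g₁ x = 0 ↔ (x : G) ∈ F 2) :
    ∃ b : ℕ, Nat.card {x : G // (p : ℤ_[p]) • x = 0} = p ^ b ∧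
      Nonempty (G ≃ₗ[ℤ_[p]] (Fin n → ℤ_[p]) × (Fin b → ℤ_[p] ⧸ Ideal.span {(p : ℤ_[p])})) := by
  have hAfin : Finite A := Nat.finite_of_card_ne_zero (by
    rw [hA]; exact pow_ne_zero _ hp.out.ne_zero)
  have hker' : ∀ x, g₁ x = 0 ↔ ∃ t : F 1, (p : ℤ_[p]) • t = x := by
    intro x
    rw [hker]
    constructor
    · intro hx
      obtain ⟨t, ht, h⟩ := hF.exists_smul_eq le_rfl hx
      exact ⟨⟨t, ht⟩, Subtype.ext h⟩
    · rintro ⟨t, rfl⟩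
      exact hF.smul_mem 1 _ t.2
  have hpow : ∀ (m : ℕ) (t : F 1), (p : ℤ_[p]) ^ m • (t : G) ∈ F m := by
    intro m t
    induction m with
    | zero => rw [hF.zero]; trivial
    | succ m ih => rw [pow_succ', mul_smul]; exact hF.smul_mem m _ ih
  have : Module.Finite ℤ_[p] (F 1) := by
    refine finite_of_finite_quotient (fun x hx => Subtype.ext (hF.eq_zero _ fun m => ?_)) g₁ ?_
    · obtain ⟨y, rfl⟩ := hx m
      exact hpow m y
    · intro x y hxy
      exact (hker' _).1 (by rw [map_sub, hxy, sub_self])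
  have := hF.isTorsionFree
  have : Module.Free ℤ_[p] (F 1) := Module.free_of_finite_type_torsion_free'
  -- F 1 / p F 1 = F 1 / F 2 ≅ A has pⁿ elements.
  have hrank : Module.finrank ℤ_[p] (F 1) = n := by
    have := card_eq_pow_of_ker_eq (Module.finBasis ℤ_[p] (F 1)).equivFun g₁ hg₁ hker'
    exact (Nat.pow_right_injective hp.out.two_le (hA.symm.trans this)).symm
  have : Finite (G ⧸ F 1) := by
    refine Finite.of_injective (fun q : G ⧸ F 1 => g₀ q.out) fun q q' h => ?_
    have := (Submodule.Quotient.eq (F 1)).2 (hg₀ _ _ h)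
    rwa [Submodule.Quotient.mk_out, Submodule.Quotient.mk_out] at this
  have : Module.Finite ℤ_[p] (G ⧸ F 1) := Module.Finite.of_finite
  have : Module.Finite ℤ_[p] G := Module.Finite.of_submodule_quotient (F 1)
  set T := Submodule.torsion ℤ_[p] G with hT
  have hG : Module.finrank ℤ_[p] G = n := by
    have h := Submodule.finrank_quotient_add_finrank (F 1)
    have h0 : Module.finrank ℤ_[p] (G ⧸ F 1) = 0 := by
      rw [Module.finrank_eq_zero_iff_isTorsion]
      intro q
      obtain ⟨x, rfl⟩ := Submodule.mkQ_surjective _ q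
      refine ⟨⟨p, mem_nonZeroDivisors_of_ne_zero (by exact_mod_cast hp.out.ne_zero)⟩, ?_⟩
      change (p : ℤ_[p]) • (F 1).mkQ x = 0
      rw [← map_smul, Submodule.mkQ_apply, Submodule.Quotient.mk_eq_zero]
      exact hF.smul_mem 0 x (by rw [hF.zero]; trivial)
    omega
  -- p x lies in the torsion-free F 1, so it vanishes as soon as x is torsion.
  have hpT : ∀ x : G, x ∈ T ↔ (p : ℤ_[p]) • x = 0 := by
    intro x
    constructor
    · rintro ⟨c, hc⟩
      have hx1 : (p : ℤ_[p]) • x ∈ F 1 := hF.smul_mem 0 x (by rw [hF.zero]; trivial)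
      have hc0 : (c : ℤ_[p]) ≠ 0 := nonZeroDivisors.ne_zero c.2
      have h0 : (c : ℤ_[p]) • (⟨_, hx1⟩ : F 1) = 0 := by
        apply Subtype.ext
        change (c : ℤ_[p]) • (p : ℤ_[p]) • x = 0
        rw [smul_comm]
        change (p : ℤ_[p]) • (c • x) = 0
        rw [hc, smul_zero]
      exact congrArg Subtype.val ((smul_eq_zero_iff_right hc0).1 h0)
    · intro hx
      exact ⟨⟨p, mem_nonZeroDivisors_of_ne_zero (by exact_mod_cast hp.out.ne_zero)⟩, hx⟩
  obtain ⟨b, hb, ⟨eT⟩⟩ := exists_linearEquiv_of_prime_smul_eq_zero (p := p) (T := T)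
    (fun x => Subtype.ext ((hpT _).1 x.2))
  have hTfin : Module.finrank ℤ_[p] T = 0 :=
    Module.finrank_eq_zero_iff_isTorsion.2 (Submodule.torsion_isTorsion)
  have hquot : Module.finrank ℤ_[p] (G ⧸ T) = n := by
    have h := Submodule.finrank_quotient_add_finrank T
    omega
  -- G/T is finitely generated and torsion-free, so it is free and the torsion splits off.
  have : Module.Free ℤ_[p] (G ⧸ T) := Module.free_of_finite_type_torsion_free'
  obtain ⟨f, hf⟩ := Module.projective_lifting_property _ LinearMap.id T.mkQ_surjective
  have eG := lequivProdOfRightSplitExact T.injective_subtype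
    (by rw [Submodule.range_subtype, Submodule.ker_mkQ]) hf
  refine ⟨b, ?_, ⟨eG.symm.trans ((LinearEquiv.prodComm _ _ _).trans (LinearEquiv.prodCongr
    (Module.finBasisOfFinrankEq ℤ_[p] (G ⧸ T) hquot).equivFun eT))⟩⟩
  rw [← hb]
  exact Nat.card_congr (Equiv.subtypeEquivRight fun x => (hpT x).symm)

lemma card_torsion_of_linearEquiv {n : ℕ} (e : G ≃ₗ[ℤ_[p]] (Fin n → ℤ_[p])) :
    Nat.card {x : G // (p : ℤ_[p]) • x = 0} = 1 := by
  rw [Nat.card_eq_one_iff_unique]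
  refine ⟨⟨fun x y => Subtype.ext ?_⟩, ⟨0, smul_zero _⟩⟩
  have h : ∀ x : G, (p : ℤ_[p]) • x = 0 → x = 0 := by
    intro x hx
    apply e.injective
    have := congrArg e hx
    rw [map_smul, map_zero] at this
    rw [map_zero]
    exact (smul_eq_zero_iff_right (by exact_mod_cast hp.out.ne_zero)).1 this
  rw [h _ x.2, h _ y.2]

end Structure

/-! ### The ring of integers of an unramified extension -/

section RingOfIntegers

variable (p : ℕ) [hp : Fact p.Prime] {K : Type*} [NormedField K] [NormedAlgebra ℚ_[p] K]
  [IsUltrametricDist K]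

lemma mem_integers_iff (x : K) : x ∈ Integers K ↔ ‖x‖ ≤ 1 := Iff.rfl

include hp in
lemma natCast_prime_ne_zero : (p : K) ≠ 0 := by
  intro h
  have := norm_natCast_prime p K
  rw [h, norm_zero] at this
  exact hp.out.ne_zero (by exact_mod_cast (inv_eq_zero.1 this.symm))

lemma pow_dvd_iff_norm_le {m : ℕ} {x : Integers K} :
    (p : Integers K) ^ m ∣ x ↔ ‖(x : K)‖ ≤ ((p : ℝ) ^ m)⁻¹ := by
  have hp0 : (0 : ℝ) < (p : ℝ) ^ m := pow_pos (by exact_mod_cast hp.out.pos) _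
  constructor
  · rintro ⟨y, rfl⟩
    have hy : ‖(y : K)‖ ≤ 1 := y.2
    push_cast
    rw [norm_mul, norm_pow, norm_natCast_prime, inv_pow]
    exact mul_le_of_le_one_right (by positivity) hy
  · intro h
    refine ⟨⟨((p : K) ^ m)⁻¹ * x, ?_⟩, ?_⟩
    · rw [mem_integers_iff, norm_mul, norm_inv, norm_pow, norm_natCast_prime, inv_pow, inv_inv]
      calc (p : ℝ) ^ m * ‖(x : K)‖ ≤ (p : ℝ) ^ m * ((p : ℝ) ^ m)⁻¹ := by gcongr
        _ = 1 := mul_inv_cancel₀ hp0.ne'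
    · apply Subtype.ext
      push_cast
      rw [mul_inv_cancel_left₀ (pow_ne_zero _ (natCast_prime_ne_zero p))]

lemma exists_pow_inv_lt {ε : ℝ} (hε : 0 < ε) : ∃ m : ℕ, ((p : ℝ) ^ m)⁻¹ < ε := by
  obtain ⟨m, hm⟩ := exists_pow_lt_of_lt_one hε
    (inv_lt_one_of_one_lt₀ (by exact_mod_cast hp.out.one_lt : (1 : ℝ) < p))
  exact ⟨m, by rwa [← inv_pow]⟩

lemma eq_zero_of_forall_pow_dvd {x : Integers K} (h : ∀ m, (p : Integers K) ^ m ∣ x) : x = 0 := by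
  apply Subtype.ext
  by_contra hx
  have hx' : (x : K) ≠ 0 := hx
  obtain ⟨m, hm⟩ := exists_pow_inv_lt p (norm_pos_iff.2 hx')
  exact absurd ((pow_dvd_iff_norm_le p).1 (h m)) (not_le.2 hm)

lemma exists_limit [CompleteSpace K] (x : ℕ → Integers K)
    (hx : ∀ m, (p : Integers K) ^ m ∣ x (m + 1) - x m) :
    ∃ y, ∀ m, (p : Integers K) ^ m ∣ y - x m := by
  have hx' : ∀ m k, (p : Integers K) ^ m ∣ x (m + k) - x m := by
    intro m k
    induction k with
    | zero => simp
    | succ k ih =>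
      have := dvd_add ((pow_dvd_pow _ (Nat.le_add_right m k)).trans (hx (m + k))) ih
      rwa [sub_add_sub_cancel] at this
  have hnorm : ∀ m k, ‖(x (m + k) : K) - x m‖ ≤ ((p : ℝ) ^ m)⁻¹ := fun m k =>
    (pow_dvd_iff_norm_le p).1 (hx' m k)
  have hc : CauchySeq fun m => (x m : K) := by
    rw [Metric.cauchySeq_iff']
    intro ε hε
    obtain ⟨N, hN⟩ := exists_pow_inv_lt p hε
    refine ⟨N, fun n hn => ?_⟩
    obtain ⟨k, rfl⟩ := Nat.exists_eq_add_of_le hn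
    rw [dist_eq_norm]
    exact (hnorm N k).trans_lt hN
  obtain ⟨y, hy⟩ := cauchySeq_tendsto_of_complete hc
  have hlim : ∀ m, ‖y - x m‖ ≤ ((p : ℝ) ^ m)⁻¹ := by
    intro m
    refine le_of_tendsto ((hy.sub_const (x m : K)).norm) ?_
    filter_upwards [Filter.eventually_ge_atTop m] with n hn
    obtain ⟨k, rfl⟩ := Nat.exists_eq_add_of_le hn
    exact hnorm m k
  have hy1 : ‖y‖ ≤ 1 := by
    refine le_of_tendsto hy.norm (Filter.Eventually.of_forall fun n => (x n).2)
  exact ⟨⟨y, hy1⟩, fun m => (pow_dvd_iff_norm_le p).2 (hlim m)⟩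

/-- The `w`-coordinate as a function of the `z`-coordinate. -/
lemma exists_curveEq [CompleteSpace K] {W : WeierstrassCurve (Integers K)}
    (hW : CoeffsDvd (p : Integers K) W) (z : Integers K) : ∃ w, CurveEq W z w := by
  -- The curve equation is w = φ(w). Each term of φ involving w has a coefficient divisible by p, so
  -- φ contracts and its iterates from 0 converge to a fixed point.
  let φ : Integers K → Integers K := fun w =>
    z ^ 3 + W.a₂ * z ^ 2 * w + W.a₄ * z * w ^ 2 + W.a₆ * w ^ 3 - W.a₁ * z * w - W.a₃ * w ^ 2
  have hφ : ∀ m w w', (p : Integers K) ^ m ∣ w - w' → (p : Integers K) ^ (m + 1) ∣ φ w - φ w' := by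
    intro m w w' h
    have e : φ w - φ w' = (W.a₂ * z ^ 2 + W.a₄ * (z * (w + w')) + W.a₆ * (w ^ 2 + w * w' + w' ^ 2)
        - W.a₁ * z - W.a₃ * (w + w')) * (w - w') := by simp only [φ]; ring
    rw [e, pow_succ']
    refine mul_dvd_mul ?_ h
    exact dvd_sub (dvd_sub (dvd_add (dvd_add (hW.a₂.mul_right _) (hW.a₄.mul_right _))
      (hW.a₆.mul_right _)) (hW.a₁.mul_right _)) (hW.a₃.mul_right _)
  have hx : ∀ m, (p : Integers K) ^ m ∣ φ^[m + 1] 0 - φ^[m] 0 := by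
    intro m
    induction m with
    | zero => simp
    | succ m ih =>
      rw [Function.iterate_succ_apply' φ (m + 1), Function.iterate_succ_apply' φ m]
      rw [Function.iterate_succ_apply' φ m] at ih
      exact hφ _ _ _ ih
  obtain ⟨w, hw⟩ := exists_limit p (fun m => φ^[m] 0) hx
  refine ⟨w, ?_⟩
  have : w - φ w = 0 := by
    refine eq_zero_of_forall_pow_dvd p fun m => ?_
    have h1 := hw (m + 1)
    have h2 := hφ m _ _ (hw m)
    rw [Function.iterate_succ_apply'] at h1
    have := dvd_sub ((pow_dvd_pow _ m.le_succ).trans h1) ((pow_dvd_pow _ m.le_succ).trans h2)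
    rwa [sub_sub_sub_cancel_right] at this
  unfold CurveEq
  simp only [φ] at this
  linear_combination this

variable (K)

/-- The embedding `ℤ_p → 𝒪_K`. -/
noncomputable def padicIntToIntegers : ℤ_[p] →+* Integers K :=
  ((algebraMap ℚ_[p] K).comp PadicInt.Coe.ringHom).codRestrict (Integers K) fun c => by
    rw [mem_integers_iff]
    change ‖algebraMap ℚ_[p] K (c : ℚ_[p])‖ ≤ 1
    rw [norm_algebraMap']
    exact c.2

omit hp [NormedAlgebra ℚ_[p] K] in
lemma residue_eq_zero_iff_dvd (hK : IsUnramified p K) (x : Integers K) :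
    IsLocalRing.residue (Integers K) x = 0 ↔ (p : Integers K) ∣ x := by
  rw [IsLocalRing.residue_eq_zero_iff, hK, Ideal.mem_span_singleton]

variable [FiniteDimensional ℚ_[p] K]

/-- A basis of K over ℚ_p, rescaled by powers of p, embeds 𝒪_K into ℤ_pⁿ and ℤ_pⁿ into 𝒪_K. The
first embedding gives finiteness and freeness, and both together give rank n. -/
lemma exists_integers_linearEquiv :
    letI := (padicIntToIntegers p K).toAlgebra
    Nonempty (Integers K ≃ₗ[ℤ_[p]] (Fin (Module.finrank ℚ_[p] K) → ℤ_[p])) := by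
  let _ : Algebra ℤ_[p] (Integers K) := (padicIntToIntegers p K).toAlgebra
  set n := Module.finrank ℚ_[p] K with hn
  have hsmul : ∀ (c : ℤ_[p]) (x : Integers K), ((c • x : Integers K) : K) = (c : ℚ_[p]) • (x : K) := by
    intro c x
    rw [Algebra.smul_def, Algebra.smul_def]
    rfl
  let e : K ≃L[ℚ_[p]] (Fin n → ℚ_[p]) := (Module.finBasisOfFinrankEq ℚ_[p] K hn.symm).equivFunL
  have hpow : ∀ C : ℝ, ∃ M : ℕ, ((p : ℝ) ^ M)⁻¹ * C ≤ 1 := by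
    intro C
    obtain ⟨M, hM⟩ := exists_pow_inv_lt p (show (0 : ℝ) < (|C| + 1)⁻¹ by positivity)
    refine ⟨M, ?_⟩
    have hC : C ≤ |C| + 1 := (le_abs_self C).trans (by linarith)
    calc ((p : ℝ) ^ M)⁻¹ * C ≤ ((p : ℝ) ^ M)⁻¹ * (|C| + 1) := by gcongr
      _ ≤ (|C| + 1)⁻¹ * (|C| + 1) := by gcongr
      _ = 1 := inv_mul_cancel₀ (by positivity)
  have hnp : ∀ M : ℕ, ‖((p : ℚ_[p]) ^ M)‖ = ((p : ℝ) ^ M)⁻¹ := fun M => by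
    rw [norm_pow, Padic.norm_p, inv_pow]
  obtain ⟨M, hM⟩ := hpow ‖(e : K →L[ℚ_[p]] (Fin n → ℚ_[p]))‖
  obtain ⟨N, hN⟩ := hpow ‖(e.symm : (Fin n → ℚ_[p]) →L[ℚ_[p]] K)‖
  have hf : ∀ (x : Integers K) i, ‖(p : ℚ_[p]) ^ M * e x i‖ ≤ 1 := by
    intro x i
    rw [norm_mul, hnp]
    refine le_trans ?_ hM
    gcongr
    calc ‖e x i‖ ≤ ‖e x‖ := norm_le_pi_norm _ _
      _ ≤ ‖(e : K →L[ℚ_[p]] (Fin n → ℚ_[p]))‖ * ‖(x : K)‖ :=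
        (e : K →L[ℚ_[p]] (Fin n → ℚ_[p])).le_opNorm _
      _ ≤ _ := mul_le_of_le_one_right (norm_nonneg _) x.2
  have hg : ∀ v : Fin n → ℤ_[p], ‖(p : ℚ_[p]) ^ N • e.symm fun i => (v i : ℚ_[p])‖ ≤ 1 := by
    intro v
    rw [norm_smul, hnp]
    refine le_trans ?_ hN
    gcongr
    refine ((e.symm : (Fin n → ℚ_[p]) →L[ℚ_[p]] K).le_opNorm _).trans
      (mul_le_of_le_one_right (norm_nonneg _) ?_)
    rw [pi_norm_le_iff_of_nonneg zero_le_one]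
    exact fun i => (v i).2
  have hp0 : (p : ℚ_[p]) ≠ 0 := by exact_mod_cast hp.out.ne_zero
  let f : Integers K →ₗ[ℤ_[p]] (Fin n → ℤ_[p]) :=
    { toFun := fun x i => ⟨(p : ℚ_[p]) ^ M * e x i, hf x i⟩
      map_add' := fun x y => by
        ext i
        change (p : ℚ_[p]) ^ M * e ((x : K) + y) i =
          (p : ℚ_[p]) ^ M * e x i + (p : ℚ_[p]) ^ M * e y i
        rw [map_add, Pi.add_apply, mul_add]
      map_smul' := fun c x => by
        ext i
        change (p : ℚ_[p]) ^ M * e ((c • x : Integers K) : K) i =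
          (c : ℚ_[p]) * ((p : ℚ_[p]) ^ M * e x i)
        rw [hsmul, map_smul, Pi.smul_apply, smul_eq_mul]
        ring }
  let g : (Fin n → ℤ_[p]) →ₗ[ℤ_[p]] Integers K :=
    { toFun := fun v => ⟨(p : ℚ_[p]) ^ N • e.symm fun i => (v i : ℚ_[p]), hg v⟩
      map_add' := fun v v' => by
        apply Subtype.ext
        change _ = (p : ℚ_[p]) ^ N • (e.symm fun i => (v i : ℚ_[p]))
          + (p : ℚ_[p]) ^ N • (e.symm fun i => (v' i : ℚ_[p]))
        rw [← smul_add, ← map_add]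
        rfl
      map_smul' := fun c v => by
        apply Subtype.ext
        rw [RingHom.id_apply, hsmul]
        change (p : ℚ_[p]) ^ N • e.symm ((c : ℚ_[p]) • fun i => (v i : ℚ_[p])) =
          (c : ℚ_[p]) • (p : ℚ_[p]) ^ N • (e.symm fun i => (v i : ℚ_[p]))
        rw [map_smul, smul_comm] }
  have hfi : Function.Injective f := by
    intro x y hxy
    apply Subtype.ext
    apply e.injective
    ext i
    have := congrArg Subtype.val (congrFun hxy i)
    exact mul_left_cancel₀ (pow_ne_zero M hp0) this
  have hgi : Function.Injective g := by
    intro v v' h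
    have h1 := congrArg Subtype.val h
    have h2 := e.symm.injective (smul_right_injective K (pow_ne_zero N hp0) h1)
    funext i
    exact Subtype.ext (congrFun h2 i)
  have : Module.Finite ℤ_[p] (Integers K) := Module.Finite.of_injective f hfi
  have : Module.IsTorsionFree ℤ_[p] (Integers K) := hfi.moduleIsTorsionFree f (map_smul f)
  have : Module.Free ℤ_[p] (Integers K) := Module.free_of_finite_type_torsion_free'
  have hr : Module.finrank ℤ_[p] (Integers K) = n := by
    apply le_antisymm
    · simpa using LinearMap.finrank_le_finrank_of_injective hfi
    · simpa using LinearMap.finrank_le_finrank_of_injective hgi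
  exact ⟨(Module.finBasisOfFinrankEq ℤ_[p] (Integers K) hr).equivFun⟩

/-- As p is a uniformizer, k = 𝒪_K / p𝒪_K, where 𝒪_K is free of rank n over ℤ_p. -/
lemma card_residue (hK : IsUnramified p K) :
    Nat.card (Residue K) = p ^ Module.finrank ℚ_[p] K := by
  let _ : Algebra ℤ_[p] (Integers K) := (padicIntToIntegers p K).toAlgebra
  obtain ⟨e⟩ := exists_integers_linearEquiv p K
  refine card_eq_pow_of_ker_eq e (IsLocalRing.residue (Integers K)).toAddMonoidHom
    IsLocalRing.residue_surjective fun x => ?_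
  refine (residue_eq_zero_iff_dvd p K hK x).trans ⟨?_, ?_⟩
  · rintro ⟨t, rfl⟩
    exact ⟨t, by rw [Algebra.smul_def, map_natCast]⟩
  · rintro ⟨t, rfl⟩
    exact ⟨t, by rw [Algebra.smul_def, map_natCast]⟩

end RingOfIntegers

/-! ### The topology of `E₀(K)` and the `ℤ_p`-module structure -/

section Continuity

variable {K : Type*} [NormedField K] [IsUltrametricDist K] [DecidableEq K]
  {W : WeierstrassCurve (Integers K)} {hW : CoeffsInMaximalIdeal W}

omit [IsUltrametricDist K] [DecidableEq K] in
lemma vec_z_one_w_ne_zero (z w : K) : ![z, 1, w] ≠ 0 := fun h => one_ne_zero (congrFun h 1)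

lemma toPlane_eq (P : goodReductionSubgroup (K := K) W hW) :
    toPlane P.1 = Projectivization.mk K ![((zCoord P : Integers K) : K), 1, ((wCoord P : Integers K) : K)]
      (vec_z_one_w_ne_zero _ _) := by
  have h := hasCoords_zCoord P
  obtain ⟨P, hP⟩ := P
  generalize zCoord (⟨P, hP⟩ : goodReductionSubgroup (K := K) W hW) = z at h ⊢
  generalize wCoord (⟨P, hP⟩ : goodReductionSubgroup (K := K) W hW) = w at h ⊢
  rcases P with _ | ⟨x, y, hxy⟩
  · obtain ⟨rfl, rfl⟩ := h
    rfl
  · obtain ⟨hx, hy⟩ := h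
    refine (Projectivization.mk_eq_mk_iff' K _ _ _ _).2 ⟨y, ?_⟩
    ext i
    fin_cases i
    · exact (mul_comm _ _).trans hx.symm
    · simp
    · exact (mul_comm _ _).trans hy

lemma continuous_zCoord :
    Continuous fun P : goodReductionSubgroup (K := K) W hW => ((zCoord P : Integers K) : K) := by
  rw [continuous_def]
  intro S hS
  -- The condition is homogeneous, so the chosen representative is irrelevant.
  let U : Set (ℙ K (Fin 3 → K)) := {q | q.rep 1 ≠ 0 ∧ q.rep 0 / q.rep 1 ∈ S}
  have hmk : ∀ (v : Fin 3 → K) (hv : v ≠ 0),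
      Projectivization.mk K v hv ∈ U ↔ v 1 ≠ 0 ∧ v 0 / v 1 ∈ S := by
    intro v hv
    obtain ⟨a, ha⟩ := Projectivization.exists_smul_eq_mk_rep K v hv
    have hr : ∀ i, (Projectivization.mk K v hv).rep i = (a : K) * v i := fun i => by
      rw [← ha]; rfl
    change (_ ≠ 0 ∧ _ / _ ∈ S) ↔ _
    rw [hr, hr, mul_div_mul_left _ _ a.ne_zero]
    simp
  have hU : IsOpen U := by
    rw [isOpen_coinduced]
    have : Projectivization.mk' K ⁻¹' U =
        {v : {v : Fin 3 → K // v ≠ 0} | v.1 1 ≠ 0 ∧ v.1 0 / v.1 1 ∈ S} := by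
      ext v
      exact hmk v.1 v.2
    rw [this, isOpen_iff_mem_nhds]
    rintro v ⟨h1, h2⟩
    have c0 : ContinuousAt (fun v : {v : Fin 3 → K // v ≠ 0} => v.1 0) v :=
      ((continuous_apply 0).comp continuous_subtype_val).continuousAt
    have c1 : ContinuousAt (fun v : {v : Fin 3 → K // v ≠ 0} => v.1 1) v :=
      ((continuous_apply 1).comp continuous_subtype_val).continuousAt
    exact Filter.inter_mem (c1.eventually_ne h1) ((c0.div c1 h1) (hS.mem_nhds h2))
  have hpre : (fun P : goodReductionSubgroup (K := K) W hW => ((zCoord P : Integers K) : K)) ⁻¹' S =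
      (fun P : goodReductionSubgroup (K := K) W hW => toPlane P.1) ⁻¹' U := by
    ext P
    rw [Set.mem_preimage, Set.mem_preimage, toPlane_eq, hmk]
    simp
  rw [hpre]
  exact hU.preimage (continuous_induced_dom.comp continuous_subtype_val)

/-- Needed so that two continuous maps agreeing on the dense subset ℕ of ℤ_p coincide. -/
instance t2Space_goodReductionSubgroup : T2Space (goodReductionSubgroup (K := K) W hW) :=
  T2Space.of_injective_continuous (f := fun P => ((zCoord P : Integers K) : K))
    (fun _ _ h => zCoord_injective (Subtype.ext h)) continuous_zCoord

lemma dvd_wCoord_sub {q : Integers K} {P Q : goodReductionSubgroup (K := K) W hW}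
    (h : q ∣ zCoord P - zCoord Q) : q ∣ wCoord P - wCoord Q := by
  rw [← Ideal.mem_span_singleton, ← Ideal.Quotient.eq] at h ⊢
  exact map_wCoord_eq _ h

variable {p : ℕ} [hp : Fact p.Prime] [NormedAlgebra ℚ_[p] K]

omit [DecidableEq K] in
lemma continuous_of_dvd_sub {g : ℤ_[p] → Integers K}
    (h : ∀ (m : ℕ) (c d : ℤ_[p]), (p : ℤ_[p]) ^ m ∣ c - d → (p : Integers K) ^ m ∣ g c - g d) :
    Continuous fun c => (g c : K) := by
  rw [Metric.continuous_iff]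
  intro d ε hε
  obtain ⟨m, hm⟩ := exists_pow_inv_lt p hε
  have hp0 : (0 : ℝ) < p := by exact_mod_cast hp.out.pos
  refine ⟨((p : ℝ) ^ m)⁻¹, by positivity, fun c hc => ?_⟩
  rw [dist_eq_norm] at hc ⊢
  refine lt_of_le_of_lt ((pow_dvd_iff_norm_le p (x := g c - g d)).1 (h m c d ?_)) hm
  rw [← Ideal.mem_span_singleton, ← PadicInt.norm_le_pow_iff_mem_span_pow, zpow_neg, zpow_natCast]
  exact hc.le

/-- Into ℙ² the map is (z : 1 : w), and congruences for z carry over to w. -/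
lemma continuous_of_dvd_zCoord_sub {f : ℤ_[p] → goodReductionSubgroup (K := K) W hW}
    (h : ∀ (m : ℕ) (c d : ℤ_[p]), (p : ℤ_[p]) ^ m ∣ c - d →
      (p : Integers K) ^ m ∣ zCoord (f c) - zCoord (f d)) : Continuous f := by
  rw [continuous_induced_rng, continuous_induced_rng]
  have e : (toPlane ∘ Subtype.val ∘ f) = fun c =>
      Projectivization.mk' K (⟨![((zCoord (f c) : Integers K) : K), 1, ((wCoord (f c) : Integers K) : K)],
        vec_z_one_w_ne_zero _ _⟩ : {v : Fin 3 → K // v ≠ 0}) :=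
    funext fun c => toPlane_eq (f c)
  rw [e]
  have hz := continuous_of_dvd_sub h
  have hw := continuous_of_dvd_sub fun m c d hcd => dvd_wCoord_sub (h m c d hcd)
  refine continuous_coinduced_rng.comp (Continuous.subtype_mk ?_ _)
  refine continuous_pi fun i => ?_
  fin_cases i
  · exact hz
  · exact continuous_const
  · exact hw

omit [NormedAlgebra ℚ_[p] K] in
lemma IsContinuousModule.eq {M M' : Module ℤ_[p] (goodReductionSubgroup (K := K) W hW)}
    (hM : IsContinuousModule p M) (hM' : IsContinuousModule p M') : M = M' := by
  refine Module.ext' _ _ fun c P => ?_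
  refine congrFun ((PadicInt.denseRange_natCast (p := p)).equalizer (hM P) (hM' P) ?_) c
  funext k
  exact (@Nat.cast_smul_eq_nsmul ℤ_[p] _ _ _ M k P).trans
    (@Nat.cast_smul_eq_nsmul ℤ_[p] _ _ _ M' k P).symm

/-- The filtration of `E₀(K)` by the subgroups `z ∈ p ^ m 𝒪_K`. -/
noncomputable def padicLevel (p : ℕ) (hW : CoeffsInMaximalIdeal W) (m : ℕ) :
    AddSubgroup (goodReductionSubgroup (K := K) W hW) :=
  level hW (Ideal.span {(p : Integers K) ^ m})

omit hp [NormedAlgebra ℚ_[p] K] in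
lemma mem_padicLevel {m : ℕ} {P : goodReductionSubgroup (K := K) W hW} :
    P ∈ padicLevel p hW m ↔ (p : Integers K) ^ m ∣ zCoord P := Ideal.mem_span_singleton

omit hp [NormedAlgebra ℚ_[p] K] in
lemma sub_mem_padicLevel {m : ℕ} {P Q : goodReductionSubgroup (K := K) W hW} :
    P - Q ∈ padicLevel p hW m ↔ (p : Integers K) ^ m ∣ zCoord P - zCoord Q :=
  sub_mem_level.trans Ideal.mem_span_singleton

lemma zCoord_surjective [CompleteSpace K] [(W.baseChange K).IsElliptic]
    (hp' : CoeffsDvd (p : Integers K) W) :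
    Function.Surjective (zCoord : goodReductionSubgroup (K := K) W hW → Integers K) := by
  intro z
  obtain ⟨w, hw⟩ := exists_curveEq p hp' z
  exact exists_zCoord_eq hw

lemma isCompleteFiltration_padicLevel [CompleteSpace K] [(W.baseChange K).IsElliptic]
    (hp' : CoeffsDvd (p : Integers K) W) :
    IsCompleteFiltration p (padicLevel (K := K) p hW) where
  zero := by
    ext P
    simp [mem_padicLevel]
  anti m m' h P hP := by
    rw [mem_padicLevel] at hP ⊢
    exact (pow_dvd_pow _ h).trans hP
  eq_zero P hP := by
    apply zCoord_injective
    rw [zCoord_zero]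
    exact eq_zero_of_forall_pow_dvd p fun m => mem_padicLevel.1 (hP m)
  complete x hx := by
    obtain ⟨z, hz⟩ := exists_limit p (fun m => zCoord (x m)) fun m => sub_mem_padicLevel.1 (hx m)
    obtain ⟨P, rfl⟩ := zCoord_surjective (hW := hW) hp' z
    exact ⟨P, fun m => sub_mem_padicLevel.2 (hz m)⟩
  nsmul_mem m P hP := by
    rw [mem_padicLevel] at hP ⊢
    have h := dvd_zCoord_nsmul_sub hp' hP p
    have h1 : (p : Integers K) ^ (m + 1) ∣ p * zCoord P := by
      rw [pow_succ']; exact mul_dvd_mul_left _ hP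
    refine (dvd_sub_left h1).1 (dvd_trans ?_ h)
    rw [pow_succ']
    exact mul_dvd_mul_left _ (dvd_pow_self _ two_ne_zero)

lemma exists_isContinuousModule [CompleteSpace K] [(W.baseChange K).IsElliptic]
    (hp' : CoeffsDvd (p : Integers K) W) :
    ∃ M : Module ℤ_[p] (goodReductionSubgroup (K := K) W hW), IsContinuousModule p M ∧
      ∀ (c : ℤ_[p]) P, IsPadicSMul (padicLevel p hW) c P (M.smul c P) := by
  obtain ⟨M, hM⟩ := (isCompleteFiltration_padicLevel (hW := hW) hp').exists_module
  refine ⟨M, fun P => ?_, hM⟩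
  exact continuous_of_dvd_zCoord_sub fun m c d h =>
    sub_mem_padicLevel.1 ((hM c P).sub_mem (hM d P) h)

end Continuity

/-! ### The torsion of `E₀(K)` -/

section Torsion

lemma map_approxLog {S T : Type*} [CommRing S] [CommRing T] (f : S →+* T)
    (c₁ c₂ c₃ c₄ c₆ z : S) :
    f (approxLog c₁ c₂ c₃ c₄ c₆ z) = approxLog (f c₁) (f c₂) (f c₃) (f c₄) (f c₆) (f z) := by
  simp [approxLog]

variable {p : ℕ} [hp : Fact p.Prime] {K : Type*} [NormedField K] [DecidableEq K]
  [NormedAlgebra ℚ_[p] K] [IsUltrametricDist K] [FiniteDimensional ℚ_[p] K]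
  {W : WeierstrassCurve (Integers K)} [(W.baseChange K).IsElliptic] {hW : CoeffsInMaximalIdeal W}

/-- The filtration of `E₀(K)` by submodules. -/
noncomputable def padicSubmodule [Module ℤ_[p] (goodReductionSubgroup (K := K) W hW)]
    (hM : ∀ (c : ℤ_[p]) P, IsPadicSMul (padicLevel (K := K) p hW) c P (c • P)) (m : ℕ) :
    Submodule ℤ_[p] (goodReductionSubgroup (K := K) W hW) where
  toAddSubmonoid := (padicLevel p hW m).toAddSubmonoid
  smul_mem' c P hP := (hM c P).mem hP

variable [Module ℤ_[p] (goodReductionSubgroup (K := K) W hW)]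
  (hM : ∀ (c : ℤ_[p]) P, IsPadicSMul (padicLevel (K := K) p hW) c P (c • P))

omit [NormedAlgebra ℚ_[p] K] [FiniteDimensional ℚ_[p] K] [(W.baseChange K).IsElliptic] in
lemma mem_padicSubmodule {m : ℕ} {P : goodReductionSubgroup (K := K) W hW} :
    P ∈ padicSubmodule hM m ↔ (p : Integers K) ^ m ∣ zCoord P := mem_padicLevel

omit [NormedAlgebra ℚ_[p] K] [FiniteDimensional ℚ_[p] K] [(W.baseChange K).IsElliptic] in
lemma sub_mem_padicSubmodule {m : ℕ} {P Q : goodReductionSubgroup (K := K) W hW} :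
    P - Q ∈ padicSubmodule hM m ↔ (p : Integers K) ^ m ∣ zCoord P - zCoord Q := sub_mem_padicLevel

include hp in
omit [DecidableEq K] [FiniteDimensional ℚ_[p] K] in
lemma natCast_prime_integers_ne_zero : (p : Integers K) ≠ 0 := fun h =>
  natCast_prime_ne_zero p (K := K) (congrArg Subtype.val h)

lemma isPadicFiltration_padicSubmodule (hp' : CoeffsDvd (p : Integers K) W) :
    IsPadicFiltration (padicSubmodule hM) := by
  have : CompleteSpace K := FiniteDimensional.complete ℚ_[p] K
  have hE := isCompleteFiltration_padicLevel (p := p) (hW := hW) hp'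
  have hp0 : (p : Integers K) ≠ 0 := natCast_prime_integers_ne_zero
  -- The error in z(pP) ≡ p z(P) is divisible by p^(2m+1), and 2m + 1 ≥ m + 2 exactly when m ≥ 1. At
  -- m = 0 this fails, and L takes over.
  have hz : ∀ (m : ℕ) (P : goodReductionSubgroup (K := K) W hW), 1 ≤ m →
      (p : Integers K) ^ m ∣ zCoord P →
      (p : Integers K) ^ (m + 2) ∣ zCoord ((p : ℤ_[p]) • P) - p * zCoord P := by
    intro m P hm h
    rw [Nat.cast_smul_eq_nsmul]
    refine dvd_trans ?_ (dvd_zCoord_nsmul_sub hp' h p)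
    rw [← pow_mul, ← pow_succ']
    exact pow_dvd_pow _ (by omega)
  refine ⟨?_, fun m m' h => hE.anti h, hE.eq_zero, hE.complete, ?_, ?_, ?_⟩
  · ext P
    simp [mem_padicSubmodule]
  · intro m P hP
    rw [Nat.cast_smul_eq_nsmul]
    exact hE.nsmul_mem m P hP
  · intro m P hm hP h
    rw [mem_padicSubmodule] at hP h ⊢
    have := (dvd_sub_right h).1 (hz m P hm hP)
    rw [pow_succ' _ (m + 1)] at this
    exact (mul_dvd_mul_iff_left hp0).1 this
  · intro m Q hm hQ
    rw [mem_padicSubmodule] at hQ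
    obtain ⟨t, ht⟩ := hQ
    obtain ⟨P, hP⟩ := zCoord_surjective (K := K) (hW := hW) hp' ((p : Integers K) ^ m * t)
    have hP' : (p : Integers K) ^ m ∣ zCoord P := ⟨t, hP⟩
    refine ⟨P, (mem_padicSubmodule hM).2 hP', ?_⟩
    rw [sub_mem_padicSubmodule, dvd_sub_comm]
    convert hz m P hm hP' using 2
    rw [ht, hP, pow_succ']
    ring

include hM in
/-- `E₀(K)` as a `ℤ_p`-module, in terms of the zeros of the reduced logarithm. -/
theorem exists_linearEquiv_of_approxLog (hK : IsUnramified p K) {n : ℕ}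
    (hn : Module.finrank ℚ_[p] K = n) {c₁ c₂ c₃ c₄ c₆ : Integers K} (h₁ : 2 * c₁ = W.a₁)
    (h₂ : 3 * c₂ = W.a₂) (h₃ : 2 * c₃ = W.a₃) (h₄ : 5 * c₄ = 2 * W.a₄) (h₆ : 7 * c₆ = 3 * W.a₆) :
    ∃ b : ℕ, Nat.card {X : Residue K // approxLog (IsLocalRing.residue (Integers K) c₁)
        (IsLocalRing.residue (Integers K) c₂) (IsLocalRing.residue (Integers K) c₃)
        (IsLocalRing.residue (Integers K) c₄) (IsLocalRing.residue (Integers K) c₆) X = 0} = p ^ b ∧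
      (Nonempty (goodReductionSubgroup (K := K) W hW ≃ₗ[ℤ_[p]] (Fin n → ℤ_[p])) → b = 0) ∧
      Nonempty (goodReductionSubgroup (K := K) W hW ≃ₗ[ℤ_[p]]
        (Fin n → ℤ_[p]) × (Fin b → ℤ_[p] ⧸ Ideal.span {(p : ℤ_[p])})) := by
  have : CompleteSpace K := FiniteDimensional.complete ℚ_[p] K
  have hp' : CoeffsDvd (p : Integers K) W := hW.coeffsDvd hK
  have hp0 : (p : Integers K) ≠ 0 := natCast_prime_integers_ne_zero
  have hF := isPadicFiltration_padicSubmodule hM hp'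
  set ρ := IsLocalRing.residue (Integers K) with hρ
  have hρ0 : ∀ x, ρ x = 0 ↔ (p : Integers K) ∣ x := residue_eq_zero_iff_dvd p K hK
  have hρs : ∀ x y, ρ x = ρ y ↔ (p : Integers K) ∣ x - y := fun x y => by
    rw [← hρ0, map_sub, sub_eq_zero]
  -- the first layer
  have hdiv : ∀ P : padicSubmodule hM 1, ∃ t, zCoord P.1 = p * t := fun P => by
    have := (mem_padicSubmodule hM).1 P.2
    rwa [pow_one] at this
  choose t ht using hdiv
  let g₁ : padicSubmodule hM 1 →+ Residue K := AddMonoidHom.mk' (fun P => ρ (t P)) fun P Q => by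
    have h := dvd_zCoord_add_sub hp' (q := (p : Integers K)) ⟨_, ht P⟩ ⟨_, ht Q⟩
    change p * (p : Integers K) ^ 2 ∣ zCoord (P + Q).1 - _ at h
    rw [ht P, ht Q, ht (P + Q)] at h
    rw [← map_add, hρs]
    have h2 : (p : Integers K) * p ∣ p * (t (P + Q) - (t P + t Q)) := by
      convert dvd_trans (mul_dvd_mul_left (p : Integers K) (dvd_pow_self _ two_ne_zero)) h using 1
      ring
    exact (mul_dvd_mul_iff_left hp0).1 h2
  have hg₁ : Function.Surjective g₁ := by
    intro X
    obtain ⟨x, rfl⟩ := IsLocalRing.residue_surjective X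
    obtain ⟨P, hP⟩ := zCoord_surjective (K := K) (hW := hW) hp' (p * x)
    refine ⟨⟨P, (mem_padicSubmodule hM).2 ⟨x, by rw [pow_one]; exact hP⟩⟩, ?_⟩
    change ρ _ = ρ _
    congr 1
    exact mul_left_cancel₀ hp0 ((ht _).symm.trans hP)
  have hker : ∀ P, g₁ P = 0 ↔ (P : goodReductionSubgroup (K := K) W hW) ∈ padicSubmodule hM 2 := by
    intro P
    rw [mem_padicSubmodule, ht P, pow_two, mul_dvd_mul_iff_left hp0]
    exact hρ0 _
  obtain ⟨b, hb, e⟩ := hF.exists_linearEquiv ((card_residue p K hK).trans (by rw [hn]))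
    (fun P => ρ (zCoord P)) (fun P Q h => by
      rw [sub_mem_padicSubmodule, pow_one]; exact (hρs _ _).1 h) g₁ hg₁ hker
  -- z(pP) ≡ p L(z(P)) modulo p², so p² divides z(pP) exactly when p divides L(z(P)).
  have hlog : ∀ P : goodReductionSubgroup (K := K) W hW,
      (p : ℤ_[p]) • P ∈ padicSubmodule hM 2 ↔
        approxLog (ρ c₁) (ρ c₂) (ρ c₃) (ρ c₄) (ρ c₆) (ρ (zCoord P)) = 0 := by
    intro P
    rw [← map_approxLog, hρ0, mem_padicSubmodule, Nat.cast_smul_eq_nsmul]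
    have h := sq_dvd_zCoord_prime_nsmul_sub hp' h₁ h₂ h₃ h₄ h₆ P
    rw [← mul_dvd_mul_iff_left hp0 (b := (p : Integers K)), ← pow_two]
    exact ⟨fun h' => (dvd_sub_right h').1 h, fun h' => (dvd_sub_left h').1 h⟩
  refine ⟨b, ?_, ?_, e⟩
  · rw [← hb]
    symm
    refine Nat.card_congr (Equiv.ofBijective (fun P => ⟨ρ (zCoord P.1), (hlog _).1 ?_⟩) ⟨?_, ?_⟩)
    · rw [P.2]; exact zero_mem _
    · rintro ⟨P, hP⟩ ⟨Q, hQ⟩ h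
      apply Subtype.ext
      -- Two torsion points with the same reduction differ by a torsion point of F 1, which is zero.
      have h' : P - Q ∈ padicSubmodule hM 1 := by
        rw [sub_mem_padicSubmodule, pow_one]
        exact (hρs _ _).1 (congrArg Subtype.val h)
      exact sub_eq_zero.1 (hF.eq_zero_of_smul h' (by rw [smul_sub, hP, hQ, sub_zero]))
    · rintro ⟨X, hX⟩
      obtain ⟨x, rfl⟩ := IsLocalRing.residue_surjective X
      obtain ⟨P, rfl⟩ := zCoord_surjective (K := K) (hW := hW) hp' x
      -- pP lies in F 2 = p F 1; subtracting the resulting Q in F 1 makes P torsion without changing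
      -- its reduction.
      obtain ⟨Q, hQ, h⟩ := hF.exists_smul_eq le_rfl ((hlog P).2 hX)
      refine ⟨⟨P - Q, by rw [smul_sub, h, sub_self]⟩, Subtype.ext ?_⟩
      refine (hρs _ _).2 ?_
      rw [← pow_one (p : Integers K), ← sub_mem_padicSubmodule hM, sub_sub_cancel_left]
      exact neg_mem hQ
  · rintro ⟨e'⟩
    have h1 := card_torsion_of_linearEquiv e'
    rw [hb] at h1
    exact (Nat.pow_eq_one.1 h1).resolve_left hp.out.ne_one

end Torsion

/-! ### Norms in finite fields -/

section FiniteField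

variable {p : ℕ} [hp : Fact p.Prime] {k : Type*} [Field k] [Finite k] [Algebra (ZMod p) k]

/-- Over 𝔽_p the norm is raising to the power (#k - 1)/(p - 1). In the cyclic group kˣ the kernel of
that map consists of the (p - 1)-th powers, and y is the inverse of a (p - 1)-th root of γ. -/
lemma exists_pow_eq_of_norm_eq_one {γ : k} (h : Algebra.norm (ZMod p) γ = 1) :
    ∃ y : k, y ≠ 0 ∧ y = γ * y ^ p := by
  have hγ0 : γ ≠ 0 := Algebra.norm_ne_zero_iff.1 (h ▸ one_ne_zero)
  have hpow : γ ^ ((Nat.card k - 1) / (p - 1)) = 1 := by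
    have := FiniteField.algebraMap_norm_eq_pow (K := ZMod p) (x := γ)
    rw [h, map_one, Nat.card_zmod] at this
    exact this.symm
  have hq : Nat.card k = p ^ Module.finrank (ZMod p) k := by
    rw [Module.natCard_eq_pow_finrank (K := ZMod p), Nat.card_zmod]
  have hdvd : p - 1 ∣ Nat.card k - 1 := by
    have := Nat.sub_dvd_pow_sub_pow p 1 (Module.finrank (ZMod p) k)
    rwa [one_pow, ← hq] at this
  obtain ⟨N, hN⟩ := hdvd
  have hp1 : 0 < p - 1 := Nat.sub_pos_of_lt hp.out.one_lt
  rw [hN, Nat.mul_div_cancel_left _ hp1] at hpow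
  obtain ⟨g, hg⟩ := IsCyclic.exists_generator (α := kˣ)
  obtain ⟨i, hi⟩ := Subgroup.mem_zpowers_iff.1 (hg (Units.mk0 γ hγ0))
  have horder : orderOf g = (p - 1) * N := by
    rw [orderOf_eq_card_of_forall_mem_zpowers hg, Nat.card_units, hN]
  have hN0 : (N : ℤ) ≠ 0 := by
    rintro h0
    have : 1 < Nat.card k := Finite.one_lt_card
    have : N = 0 := by exact_mod_cast h0
    subst this
    omega
  obtain ⟨j, rfl⟩ : ((p - 1 : ℕ) : ℤ) ∣ i := by
    have h1 : g ^ (i * N) = 1 := by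
      rw [zpow_mul, hi, zpow_natCast]
      exact Units.ext (by simpa using hpow)
    rw [← orderOf_dvd_iff_zpow_eq_one, horder, Nat.cast_mul] at h1
    exact (mul_dvd_mul_iff_right hN0).1 h1
  refine ⟨((g ^ j)⁻¹ : kˣ), Units.ne_zero _, ?_⟩
  have hγ : γ = (((g ^ j) ^ (p - 1) : kˣ) : k) := by
    rw [← zpow_natCast, ← zpow_mul, mul_comm j, hi, Units.val_mk0]
  rw [hγ, ← Units.val_pow_eq_pow_val, ← Units.val_mul]
  congr 1
  have hsucc : (g ^ j)⁻¹ ^ p = (g ^ j)⁻¹ ^ (p - 1) * (g ^ j)⁻¹ := by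
    rw [← pow_succ, Nat.sub_add_cancel hp.out.one_le]
  rw [hsucc, ← mul_assoc, inv_pow, mul_inv_cancel, one_mul]

/-- The zeros of `X - γ X ^ p` in a finite field. -/
lemma card_sub_mul_pow_eq_zero (γ : k) :
    (Algebra.norm (ZMod p) γ ≠ 1 → Nat.card {X : k // X - γ * X ^ p = 0} = 1) ∧
    (Algebra.norm (ZMod p) γ = 1 → 1 < Nat.card {X : k // X - γ * X ^ p = 0} ∧
      Nat.card {X : k // X - γ * X ^ p = 0} ≤ p) := by
  have hp1 : p ≠ 0 := hp.out.ne_zero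
  constructor
  · intro h
    rw [Nat.card_eq_one_iff_unique]
    refine ⟨⟨fun x y => Subtype.ext ?_⟩, ⟨0, by simp [hp1]⟩⟩
    have key : ∀ x : k, x - γ * x ^ p = 0 → x = 0 := by
      intro x hx
      by_contra hx0
      apply h
      -- N(x) lies in 𝔽_p, so N(x)^p = N(x), and x = γ x^p forces N(γ) = 1.
      have e := congrArg (Algebra.norm (ZMod p)) (sub_eq_zero.1 hx)
      rw [map_mul, map_pow, ZMod.pow_card] at e
      exact (mul_right_cancel₀ (Algebra.norm_ne_zero_iff.2 hx0)
        (by rw [one_mul]; exact e)).symm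
    rw [key _ x.2, key _ y.2]
  · intro h
    obtain ⟨y, hy0, hy⟩ := exists_pow_eq_of_norm_eq_one h
    constructor
    · rw [Finite.one_lt_card_iff_nontrivial]
      exact ⟨⟨0, by simp [hp1]⟩, ⟨y, sub_eq_zero.2 hy⟩, fun e => hy0 (congrArg Subtype.val e).symm⟩
    · classical
      have := Fintype.ofFinite k
      -- A bound by the degree is enough, because the count will be known to be a power of p.
      let f : Polynomial k := Polynomial.X - Polynomial.C γ * Polynomial.X ^ p
      have hf : f ≠ 0 := by
        intro hf
        have := congrArg (fun f => Polynomial.coeff f 1) hf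
        simp [f, Polynomial.coeff_X_pow, hp.out.ne_one.symm] at this
      have hdeg : f.natDegree ≤ p := by
        refine (Polynomial.natDegree_sub_le _ _).trans (max_le ?_ ?_)
        · rw [Polynomial.natDegree_X]; exact hp.out.one_le
        · exact Polynomial.natDegree_C_mul_X_pow_le _ _
      rw [Nat.card_eq_fintype_card, Fintype.card_subtype]
      refine (Finset.card_le_card (t := f.roots.toFinset) fun x hx => ?_).trans
        ((Multiset.toFinset_card_le _).trans ((Polynomial.card_roots' f).trans hdeg))
      rw [Finset.mem_filter] at hx
      rw [Multiset.mem_toFinset, Polynomial.mem_roots hf, Polynomial.IsRoot.def]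
      simpa [f] using hx.2

end FiniteField

/-! ### The exceptional cases -/

section Cases

variable {p : ℕ} [hp : Fact p.Prime] {K : Type*} [NormedField K]
  [NormedAlgebra ℚ_[p] K] [IsUltrametricDist K]

include hp in
lemma residue_natCast_ne_zero {q : ℕ} (hq : q.Prime) (h : p ≠ q) :
    (q : Residue K) ≠ 0 := by
  have := charP_residue p K
  rw [Ne, CharP.cast_eq_zero_iff (Residue K) p, Nat.prime_dvd_prime_iff_eq hp.out hq]
  exact h

/-- Division by a prime `q` of an element of `p 𝒪_K`. -/
lemma exists_prime_mul_eq {q : ℕ} (hq : q.Prime) {a : Integers K} (ha : (p : Integers K) ∣ a) :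
    ∃ c : Integers K, (q : Integers K) * c = a ∧
      (p ≠ q → IsLocalRing.residue (Integers K) c = 0) ∧
      (p = q → IsLocalRing.residue (Integers K) c = divResidue p a) := by
  by_cases h : p = q
  · subst h
    obtain ⟨c, rfl⟩ := ha
    exact ⟨c, rfl, fun h => absurd rfl h, fun _ => (divResidue_mul p c).symm⟩
  -- For q ≠ p, q is a unit of 𝒪_K, so the quotient a/q stays divisible by p and vanishes in k.
  · have hu : IsUnit (q : Integers K) := by
      have := residue_natCast_ne_zero (K := K) hq h
      rwa [← map_natCast (IsLocalRing.residue (Integers K)), IsLocalRing.residue_ne_zero_iff_isUnit]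
        at this
    obtain ⟨u, hu⟩ := hu
    refine ⟨↑u⁻¹ * a, by rw [← hu, Units.mul_inv_cancel_left], fun _ => ?_, fun h' => absurd h' h⟩
    obtain ⟨c, rfl⟩ := ha
    rw [map_mul, map_mul, map_natCast]
    have := charP_residue p K
    rw [CharP.cast_eq_zero]
    simp

include hp in
lemma finite_residue [FiniteDimensional ℚ_[p] K] (hK : IsUnramified p K) : Finite (Residue K) :=
  Nat.finite_of_card_ne_zero (by
    rw [card_residue p K hK]; exact pow_ne_zero _ hp.out.ne_zero)

/-- The number of zeros of `X - γ X ^ p` in `k`. -/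
lemma eq_zero_or_eq_one_of_card [FiniteDimensional ℚ_[p] K] (hK : IsUnramified p K)
    (γ : Residue K) {b : ℕ}
    (hb : Nat.card {X : Residue K // X - γ * X ^ p = 0} = p ^ b) :
    (residueNorm p K γ ≠ 1 → b = 0) ∧ (residueNorm p K γ = 1 → b = 1) := by
  let _ := charP_residue p K
  let _ := ZMod.algebra (Residue K) p
  have := finite_residue hK
  obtain ⟨h₀, h₁⟩ := card_sub_mul_pow_eq_zero (p := p) γ
  rw [hb] at h₀ h₁
  constructor
  · intro h
    exact (Nat.pow_eq_one.1 (h₀ h)).resolve_left hp.out.ne_one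
  · intro h
    obtain ⟨h2, h3⟩ := h₁ h
    have h4 : b ≤ 1 := (Nat.pow_le_pow_iff_right hp.out.one_lt).1 (by rwa [pow_one])
    have h5 : b ≠ 0 := by rintro rfl; simp at h2
    omega

/-- The number of zeros of `α₃ X ^ 4 + α₁ X ^ 2 - X` in `k`. -/
lemma two_pow_eq_zero_iff {k : Type*} [Field k] (α₁ α₃ : k) {b : ℕ}
    (hb : Nat.card {X : k // α₃ * X ^ 4 + α₁ * X ^ 2 - X = 0} = 2 ^ b) :
    b = 0 ↔ ¬ ∃ x : k, α₃ * x ^ 3 + α₁ * x - 1 = 0 := by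
  have h0 : α₃ * (0 : k) ^ 4 + α₁ * 0 ^ 2 - 0 = 0 := by ring
  constructor
  · rintro rfl ⟨x, hx⟩
    rw [pow_zero, Nat.card_eq_one_iff_unique] at hb
    obtain ⟨hs, -⟩ := hb
    have hx4 : α₃ * x ^ 4 + α₁ * x ^ 2 - x = 0 := by linear_combination x * hx
    have : x = 0 := congrArg Subtype.val (hs.elim ⟨x, hx4⟩ ⟨0, h0⟩)
    rw [this] at hx
    simp at hx
  · intro h
    have : Nat.card {X : k // α₃ * X ^ 4 + α₁ * X ^ 2 - X = 0} = 1 := by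
      rw [Nat.card_eq_one_iff_unique]
      refine ⟨⟨fun x y => Subtype.ext ?_⟩, ⟨0, h0⟩⟩
      have key : ∀ x : k, α₃ * x ^ 4 + α₁ * x ^ 2 - x = 0 → x = 0 := by
        intro x hx
        have : x * (α₃ * x ^ 3 + α₁ * x - 1) = 0 := by linear_combination hx
        exact (mul_eq_zero.1 this).resolve_right fun h' => h ⟨x, h'⟩
      rw [key _ x.2, key _ y.2]
    rw [this] at hb
    exact (Nat.pow_eq_one.1 hb.symm).resolve_left (by norm_num)

variable [DecidableEq K] [FiniteDimensional ℚ_[p] K]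
  {W : WeierstrassCurve (Integers K)} [(W.baseChange K).IsElliptic] {hW : CoeffsInMaximalIdeal W}

/-- The structure of `E₀(K)`, with the number of exceptional summands in each case. -/
theorem exists_linearEquiv_cases [Module ℤ_[p] (goodReductionSubgroup (K := K) W hW)]
    (hM : ∀ (c : ℤ_[p]) P, IsPadicSMul (padicLevel (K := K) p hW) c P (c • P))
    (hK : IsUnramified p K) {n : ℕ} (hn : Module.finrank ℚ_[p] K = n) :
    ∃ b : ℕ,
      (Nonempty (goodReductionSubgroup (K := K) W hW ≃ₗ[ℤ_[p]] (Fin n → ℤ_[p])) → b = 0) ∧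
      Nonempty (goodReductionSubgroup (K := K) W hW ≃ₗ[ℤ_[p]]
        (Fin n → ℤ_[p]) × (Fin b → ℤ_[p] ⧸ Ideal.span {(p : ℤ_[p])})) ∧
      (b = 0 ↔ ¬ (ExceptionalTwo p W ∨ ExceptionalThree p W ∨ ExceptionalFive p W ∨
          ExceptionalSeven p W)) ∧
      (ExceptionalTwo p W → 2 ^ b = Nat.card {X : Residue K //
          divResidue p W.a₃ * X ^ 4 + divResidue p W.a₁ * X ^ 2 - X = 0}) ∧
      (ExceptionalThree p W ∨ ExceptionalFive p W ∨ ExceptionalSeven p W → b = 1) := by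
  have hp' : CoeffsDvd (p : Integers K) W := hW.coeffsDvd hK
  obtain ⟨c₁, h₁, n₁, e₁⟩ := exists_prime_mul_eq Nat.prime_two hp'.a₁
  obtain ⟨c₂, h₂, n₂, e₂⟩ := exists_prime_mul_eq Nat.prime_three hp'.a₂
  obtain ⟨c₃, h₃, n₃, e₃⟩ := exists_prime_mul_eq Nat.prime_two hp'.a₃
  obtain ⟨c₄, h₄, n₄, e₄⟩ := exists_prime_mul_eq Nat.prime_five hp'.a₄
  obtain ⟨c₆, h₆, n₆, e₆⟩ := exists_prime_mul_eq Nat.prime_seven hp'.a₆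
  -- Here 5c₄ = a₄ and 7c₆ = a₆, so the coefficients 2a₄/5 and 3a₆/7 of L are 2c₄ and 3c₆.
  obtain ⟨b, hb, hb₀, hG⟩ := exists_linearEquiv_of_approxLog hM hK hn (c₁ := c₁) (c₂ := c₂)
    (c₃ := c₃) (c₄ := 2 * c₄) (c₆ := 3 * c₆) (by exact_mod_cast h₁) (by exact_mod_cast h₂)
    (by exact_mod_cast h₃) (by rw [← h₄]; push_cast; ring) (by rw [← h₆]; push_cast; ring)
  refine ⟨b, hb₀, hG, ?_⟩
  rw [map_mul, map_mul, map_ofNat, map_ofNat] at hb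
  unfold approxLog at hb
  have hchar := charP_residue p K
  by_cases hp2 : p = 2
  · rw [e₁ hp2, n₂ (by omega), e₃ hp2, n₄ (by omega), n₆ (by omega)] at hb
    have hb' : Nat.card {X : Residue K //
        divResidue p W.a₃ * X ^ 4 + divResidue p W.a₁ * X ^ 2 - X = 0} = 2 ^ b := by
      rw [show 2 ^ b = p ^ b by rw [hp2], ← hb]
      exact Nat.card_congr (Equiv.subtypeEquivRight fun X =>
        ⟨fun h => by linear_combination -h, fun h => by linear_combination -h⟩)
    have hiff := two_pow_eq_zero_iff _ _ hb'
    have h3 : ¬ ExceptionalThree p W := fun h => by have := h.1; omega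
    have h5 : ¬ ExceptionalFive p W := fun h => by have := h.1; omega
    have h7 : ¬ ExceptionalSeven p W := fun h => by have := h.1; omega
    have hE : ¬ (ExceptionalThree p W ∨ ExceptionalFive p W ∨ ExceptionalSeven p W) :=
      not_or.2 ⟨h3, not_or.2 ⟨h5, h7⟩⟩
    refine ⟨hiff.trans (not_congr ⟨fun h => Or.inl ⟨hp2, h⟩, fun h => (h.resolve_right hE).2⟩),
      fun _ => hb'.symm, fun h => absurd h hE⟩
  have hE2 : ¬ ExceptionalTwo p W := fun h => hp2 h.1
  rw [n₁ hp2, n₃ hp2] at hb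
  -- the case of an odd prime, where the reduced logarithm is `X - γ X ^ p`
  have odd : ∀ γ : Residue K, Nat.card {X : Residue K // X - γ * X ^ p = 0} = p ^ b →
      (residueNorm p K γ = 1 ↔ ExceptionalThree p W ∨ ExceptionalFive p W ∨
        ExceptionalSeven p W) →
      (b = 0 ↔ ¬ (ExceptionalTwo p W ∨ ExceptionalThree p W ∨ ExceptionalFive p W ∨
          ExceptionalSeven p W)) ∧
      (ExceptionalTwo p W → 2 ^ b = Nat.card {X : Residue K //
          divResidue p W.a₃ * X ^ 4 + divResidue p W.a₁ * X ^ 2 - X = 0}) ∧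
      (ExceptionalThree p W ∨ ExceptionalFive p W ∨ ExceptionalSeven p W → b = 1) := by
    intro γ hγ hiff
    obtain ⟨h0, h1⟩ := eq_zero_or_eq_one_of_card hK γ hγ
    refine ⟨⟨fun h h' => ?_, fun h => h0 fun h' => h (Or.inr (hiff.1 h'))⟩,
      fun h => absurd h hE2, fun h => h1 (hiff.2 h)⟩
    have := h1 (hiff.2 (h'.resolve_left hE2))
    omega
  have congr_card : ∀ {f g : Residue K → Residue K}, (∀ X, f X = g X) →
      Nat.card {X // f X = 0} = Nat.card {X // g X = 0} := fun h => by
    simp only [h]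
  by_cases hp3 : p = 3
  · rw [e₂ hp3, n₄ (by omega), n₆ (by omega)] at hb
    have hc : (3 : Residue K) = 0 := by
      have := CharP.cast_eq_zero (Residue K) p
      rw [hp3] at this
      exact_mod_cast this
    -- L reduces to X + (a₂/3) X³, and -1 = 8 in characteristic 3.
    refine odd (8 * divResidue p W.a₂) ?_ ⟨fun h => Or.inl ⟨hp3, h⟩, ?_⟩
    · rw [← hb]
      refine congr_card fun X => ?_
      rw [show X ^ p = X ^ 3 by rw [hp3]]
      linear_combination (-3 * divResidue p W.a₂ * X ^ 3) * hc
    · rintro (h | h | h)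
      · exact h.2
      · exact absurd h.1 (by omega)
      · exact absurd h.1 (by omega)
  by_cases hp5 : p = 5
  · rw [n₂ hp3, e₄ hp5, n₆ (by omega)] at hb
    have hc : (5 : Residue K) = 0 := by
      have := CharP.cast_eq_zero (Residue K) p
      rw [hp5] at this
      exact_mod_cast this
    -- L reduces to X + 2(a₄/5) X⁵, and -2 = 3 in characteristic 5.
    refine odd (3 * divResidue p W.a₄) ?_ ⟨fun h => Or.inr (Or.inl ⟨hp5, h⟩), ?_⟩
    · rw [← hb]
      refine congr_card fun X => ?_
      rw [show X ^ p = X ^ 5 by rw [hp5]]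
      linear_combination (-divResidue p W.a₄ * X ^ 5) * hc
    · rintro (h | h | h)
      · exact absurd h.1 (by omega)
      · exact h.2
      · exact absurd h.1 (by omega)
  by_cases hp7 : p = 7
  · rw [n₂ hp3, n₄ hp5, e₆ hp7] at hb
    have hc : (7 : Residue K) = 0 := by
      have := CharP.cast_eq_zero (Residue K) p
      rw [hp7] at this
      exact_mod_cast this
    -- L reduces to X + 3(a₆/7) X⁷, and -3 = 4 in characteristic 7.
    refine odd (4 * divResidue p W.a₆) ?_ ⟨fun h => Or.inr (Or.inr ⟨hp7, h⟩), ?_⟩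
    · rw [← hb]
      refine congr_card fun X => ?_
      rw [show X ^ p = X ^ 7 by rw [hp7]]
      linear_combination (-divResidue p W.a₆ * X ^ 7) * hc
    · rintro (h | h | h)
      · exact absurd h.1 (by omega)
      · exact absurd h.1 (by omega)
      · exact h.2
  · rw [n₂ hp3, n₄ hp5, n₆ hp7] at hb
    -- For all other primes L reduces to X, so γ = 0, whose norm is 0.
    refine odd 0 ?_ ⟨fun h => ?_, ?_⟩
    · rw [← hb]
      exact congr_card fun X => by ring
    · exfalso
      let _ := ZMod.algebra (Residue K) p
      have := finite_residue hK
      have h0 : residueNorm p K 0 = 0 := Algebra.norm_zero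
      rw [h0] at h
      exact zero_ne_one h
    · rintro (h | h | h)
      · exact absurd h.1 hp3
      · exact absurd h.1 hp5
      · exact absurd h.1 hp7

end Cases

end AdditiveReduction

/-! ### The main theorem -/

open AdditiveReduction in
theorem theorem1p1 (p : ℕ) [Fact p.Prime] (K : Type*) [NormedField K] [DecidableEq K]
    [NormedAlgebra ℚ_[p] K] [IsUltrametricDist K] [FiniteDimensional ℚ_[p] K]
    (hK : IsUnramified p K) (n : ℕ) (hn : Module.finrank ℚ_[p] K = n)
    (W : WeierstrassCurve (Integers K)) [(W.baseChange K).IsElliptic]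
    (hW : CoeffsInMaximalIdeal W) :
    -- `E₀(K)` is a `ℤ_p`-module in exactly one way that is continuous for its standard topology
    (∃! M : Module ℤ_[p] (goodReductionSubgroup (K := K) W hW), IsContinuousModule p M) ∧
    ∀ M : Module ℤ_[p] (goodReductionSubgroup (K := K) W hW), IsContinuousModule p M →
      -- the generic case occurs exactly outside of the four exceptional cases
      (Nonempty (goodReductionSubgroup (K := K) W hW ≃ₗ[ℤ_[p]] (Fin n → ℤ_[p])) ↔
        ¬ (ExceptionalTwo p W ∨ ExceptionalThree p W ∨ ExceptionalFive p W ∨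
          ExceptionalSeven p W)) ∧
      -- the exceptional cases
      (ExceptionalTwo p W → ∃ b : ℕ,
        2 ^ b = Nat.card {X : Residue K //
          divResidue p W.a₃ * X ^ 4 + divResidue p W.a₁ * X ^ 2 - X = 0} ∧
        Nonempty (goodReductionSubgroup (K := K) W hW ≃ₗ[ℤ_[p]]
          (Fin n → ℤ_[p]) × (Fin b → ℤ_[p] ⧸ Ideal.span {(p : ℤ_[p])}))) ∧
      (ExceptionalThree p W ∨ ExceptionalFive p W ∨ ExceptionalSeven p W →
        Nonempty (goodReductionSubgroup (K := K) W hW ≃ₗ[ℤ_[p]]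
          (Fin n → ℤ_[p]) × (ℤ_[p] ⧸ Ideal.span {(p : ℤ_[p])}))) := by
  have hp' : CoeffsDvd (p : Integers K) W := hW.coeffsDvd hK
  have : CompleteSpace K := FiniteDimensional.complete ℚ_[p] K
  obtain ⟨M₀, hM₀, hspec⟩ := exists_isContinuousModule (hW := hW) hp'
  refine ⟨⟨M₀, hM₀, fun M hM => hM.eq hM₀⟩, fun M hM => ?_⟩
  obtain rfl : M = M₀ := hM.eq hM₀
  obtain ⟨b, h₀, ⟨e⟩, hiff, h₂, h₁⟩ := exists_linearEquiv_cases hspec hK hn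
  refine ⟨⟨fun h => hiff.1 (h₀ h), fun h => ?_⟩, fun h => ⟨b, h₂ h, ⟨e⟩⟩, fun h => ?_⟩
  · obtain rfl := hiff.2 h
    exact ⟨e.trans LinearEquiv.prodUnique⟩
  · obtain rfl := h₁ h
    exact ⟨e.trans (LinearEquiv.prodCongr (LinearEquiv.refl _ _) (LinearEquiv.funUnique (Fin 1) _ _))⟩
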